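/- Consider the Cauchy problem $$u_t+f(k(x),u)_x=0\quad\text{on }\mathbb R\times[0,\infty),\qquad u(x,0)=u_0(x),$$ under the following assumptions. The initial datum $u_0\in L^\infty(\mathbb R)$ satisfies $u_0(x)\in[\underline u,\overline u]$ for a.e. $x$. The coefficient $k:\mathbb R\to\mathbb R$ has bounded variation, $k(x)\in[\underline k,\overline k]$ for a.e. $x$, it is $C^1$ off a finite set, and its set of discontinuities $D=\{x_1,\dots,x_M\}$ is finite; $k_m^\pm$ denote the one-sided limits of $k$ at $x_m$. For every $\kappa\in[\underline k,\overline k]$ we have $f(\kappa,\cdot)\in C^3[\underline u,\overline u]$, and for every $v\in\mathbb R$ we have $f(\cdot,v)\in C^2[\underline k,\overline k]$ with $\partial^2_{\kappa\kappa}f\equiv 0$ (only $f(\kappa,v)$ with $v\in[\underline u,\overline u]$ enters the scheme; for other $v$ this is any extension of the flux, which gives meaning to $f(\kappa,c)$ for all $c\in\mathbb R$). Fix $\lambda>0$ satisfying the CFL condition $\lambda|f_u(\kappa,v)|\le\frac12$ for all $(\kappa,v)\in[\underline k,\overline k]\times[\underline u,\overline u]$. Take mesh sizes $\Delta x>0$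 running through a sequence that tends to $0$, and put $\Delta t=\lambda\Delta x$, $t^n=n\Delta t$, $x_j=j\Delta x$ for $j\in\frac12\mathbb Z$. Put $k_j=\frac1{\Delta x}\int_{x_{j-1/2}}^{x_{j+1/2}}k\,dx$ for $j\in\frac12\mathbb Z$ and $u_j^0=\frac1{\Delta x}\int_{x_{j-1/2}}^{x_{j+1/2}}u_0\,dx$ for $j\in\mathbb Z$. On the staggered grid (at time level $n$ the indices are the $j\in\frac12\mathbb Z$ with $j+\frac n2\in\mathbb Z$) suppose that the numerical values are given by $$u^{n+1}_{j+\frac12}=\bar u^{n+1}_{j+\frac12}-a^{n+1}_{j+1}+a^{n+1}_j,\qquad n\ge0,$$ where: (i) $\bar u^{n+1}_{j+\frac12}=\frac12(u_j^n+u_{j+1}^n)-\lambda\big(f(k_{j+1},u_{j+1}^n)-f(k_j,u_j^n)\big)$ is the Lax–Friedrichs predictor; (ii) $|a_j^{n+1}|\le\mathcal K\,\Delta x^\alpha$ for all $n\ge 0$ and all $j$ with $j+\frac n2\in\mathbb Z$, with a constant $\mathcal K$ independent of $\Delta x$ and some $\alpha>\frac23$; (iii) the approximate solutions $u_\Delta$,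 defined by $u_\Delta=u_j^n$ on $[x_{j-\frac12},x_{j+\frac12})\times[t^n,t^{n+1})$ for $j+\frac n2\in\mathbb Z$, are bounded uniformly in $\Delta x$, with values in $[\underline u,\overline u]$; for all $X,T>0$ there is a constant $C$ independent of $\Delta x$ such that, with $N=\lfloor T/\Delta t\rfloor+1$ and $J=\lfloor X/\Delta x\rfloor+1$, $$\Delta x\sum_{n=0}^{N-1}\ \sum_{|j|\le J,\ j+\frac n2\in\mathbb Z}|u^n_{j+1}-u^n_j|^3\le C;$$ and $u_\Delta\to u$ a.e. on $\mathbb R\times[0,\infty)$ as $\Delta x\to0$. Then $u$ is an entropy solution: $u\in L^\infty(\mathbb R\times[0,\infty))$ and, for all $c\in\mathbb R$ and all nonnegative $\phi\in C_c^\infty(\mathbb R\times[0,\infty))$, $$\iint_{\mathbb R\times[0,\infty)}\big(|u-c|\phi_t+\operatorname{sgn}(u-c)(f(k(x),u)-f(k(x),c))\phi_x\big)\,dx\,dt+\int_{\mathbb R}|u_0-c|\,\phi(x,0)\,dx$$ $$+\iint_{(\mathbb R\setminus D)\times[0,\infty)}|f(k(x),c)_x|\,\phi\,dx\,dt+\sum_{m=1}^M\int_0^\infty|f(k_m^+,c)-f(k_m^-,c)|\,\phi(x_m,t)\,dt\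 \ge\ 0.$$ -/

import Mathlib

open MeasureTheory Filter Topology Set
open scoped ContDiff

/-- The average of `g` over the mesh cell of width `dx` centred at the point `i * dx / 2`.
Grid points are indexed by twice their spatial index: the integer `i = 2 * j` stands for
`x_j = j * dx`, where `j` is an integer or a half-integer. -/
noncomputable def cellAverage (g : ℝ → ℝ) (dx : ℝ) (i : ℤ) : ℝ :=
  (1 / dx) * ∫ x in (((i : ℝ) - 1) * dx / 2)..(((i : ℝ) + 1) * dx / 2), g x

/-- The staggered Lax–Friedrichs update at the point of index `i + 1`, computed from the values
`v` at the neighbouring points of index `i` and `i + 2`: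
`(v_j + v_{j+1}) / 2 - lam * (f (k_{j+1}, v_{j+1}) - f (k_j, v_j))` with `i = 2 * j`. -/
noncomputable def laxFriedrichsStep (f : ℝ → ℝ → ℝ) (k : ℝ → ℝ) (lam dx : ℝ) (v : ℤ → ℝ)
    (i : ℤ) : ℝ :=
  (1 / 2) * (v i + v (i + 2)) -
    lam * (f (cellAverage k dx (i + 2)) (v (i + 2)) - f (cellAverage k dx i) (v i))

/-- `U n i` is the numerical value at time level `n` at the point `i * dx / 2`; only the indices
`i` with the parity of `n` belong to the staggered grid at level `n`. The initial values are the
cell averages of `u0`, and each step is a Lax–Friedrichs predictor followed by the correction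
`- a^{n+1}_{j+1} + a^{n+1}_j`. -/
def IsPredictorCorrector (f : ℝ → ℝ → ℝ) (k u0 : ℝ → ℝ) (lam dx : ℝ)
    (U a : ℕ → ℤ → ℝ) : Prop :=
  (∀ i : ℤ, Even i → U 0 i = cellAverage u0 dx i) ∧
  ∀ (n : ℕ) (i : ℤ), Even (i + (n : ℤ)) →
    U (n + 1) (i + 1) = laxFriedrichsStep f k lam dx (U n) i - a (n + 1) (i + 2) + a (n + 1) i

/-- The piecewise constant function with the value `U n i` on
`[(i - 1) * dx / 2, (i + 1) * dx / 2) × [n * dt, (n + 1) * dt)`, for `i` of the parity of `n`. -/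
noncomputable def approxSolution (dx dt : ℝ) (U : ℕ → ℤ → ℝ) (x t : ℝ) : ℝ :=
  if Even ⌊t / dt⌋₊ then U ⌊t / dt⌋₊ (2 * ⌊x / dx + 1 / 2⌋)
  else U ⌊t / dt⌋₊ (2 * ⌊x / dx⌋ + 1)

/-- `dx * ∑_{n < N} ∑_{|j| ≤ J, j + n/2 ∈ ℤ} |u^n_{j+1} - u^n_j| ^ 3` with
`N = ⌊T / dt⌋ + 1` and `J = ⌊X / dx⌋ + 1` (here `i = 2 * j`). -/
noncomputable def cubicSum (dx dt : ℝ) (U : ℕ → ℤ → ℝ) (X T : ℝ) : ℝ :=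
  dx * ∑ n ∈ Finset.range (⌊T / dt⌋₊ + 1),
    ∑ i ∈ (Finset.Icc (-(2 * (⌊X / dx⌋ + 1))) (2 * (⌊X / dx⌋ + 1))).filter
      (fun i : ℤ => Even (i + (n : ℤ))), |U n (i + 2) - U n i| ^ 3

/-- Kruzhkov-type entropy solutions of `u_t + f(k(x), u)_x = 0`, `u(x, 0) = u0(x)` on
`ℝ × [0, ∞)`, where `D` is the finite set of discontinuities of `k`. The test functions are the
smooth compactly supported functions on the closed half plane `t ≥ 0` (restrictions of smooth
compactly supported functions on the plane), nonnegative there and not required to vanish at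
`t = 0`. -/
def IsEntropySolution (f : ℝ → ℝ → ℝ) (k : ℝ → ℝ) (D : Finset ℝ) (u0 : ℝ → ℝ)
    (u : ℝ → ℝ → ℝ) : Prop :=
  MemLp (fun p : ℝ × ℝ => u p.1 p.2) ⊤ (volume.restrict {p : ℝ × ℝ | 0 ≤ p.2}) ∧
  ∀ (c : ℝ) (φ : ℝ × ℝ → ℝ), ContDiff ℝ ∞ φ → HasCompactSupport φ →
    (∀ p : ℝ × ℝ, 0 ≤ p.2 → 0 ≤ φ p) →
    0 ≤ (∫ p in {p : ℝ × ℝ | 0 ≤ p.2},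
          (|u p.1 p.2 - c| * deriv (fun t => φ (p.1, t)) p.2 +
            Real.sign (u p.1 p.2 - c) * (f (k p.1) (u p.1 p.2) - f (k p.1) c) *
              deriv (fun x => φ (x, p.2)) p.1)) +
        (∫ x, |u0 x - c| * φ (x, 0)) +
        (∫ p in {p : ℝ × ℝ | p.1 ∉ D ∧ 0 ≤ p.2}, |deriv (fun x => f (k x) c) p.1| * φ p) +
        ∑ y ∈ D, ∫ t in Ici (0 : ℝ),
          |f (Function.rightLim k y) c - f (Function.leftLim k y) c| * φ (y, t)

/-!
Under the CFL condition the Lax–Friedrichs step is monotone, hence satisfies a discrete Kruzhkov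
inequality for every constant `s`, up to the variation of the flux `f (·, s)` between the cells. The
corrections `a` are too large to be estimated against `|· - s|` itself. Averaging the inequalities
over `s ∈ [c, c + ε]` gives an entropy whose derivative is Lipschitz with constant `2 / ε`, so that
summing the corrections by parts leaves terms of size `dx ^ α / dx * (|u_{j+1} - u_j| / ε + dx)`.
With `α = 2 / 3 + 2 * β`, `ε = dx ^ β` and `y ≤ τ + y ^ 3 / τ ^ 2` for `τ = dx ^ (1 / 3)`, the cubic
estimate makes their sum vanish in the limit.

Since `f` is affine in the coefficient, the variation of the flux between neighbouring cells is
`|B c|` times `|k_{j+1} - k_j|`, which is at most the increment of the cell averages of a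
distribution function `V` of the total variation of `k`. The increment of `V` can be moved into the
entropy flux; the argument of Lax and Wendroff then gives an inequality for the limit in which `V`
is multiplied by `φ_x`, and an integration by parts replaces `-V φ_x` by `φ dV`, where `dV` consists
of `|k'| dx` and the jumps of `k`.
-/

/-- The index of the cell containing `x` in the staggered grid at level `n`; it has the parity of
`n`. -/
noncomputable def gridIndex (dx : ℝ) (n : ℕ) (x : ℝ) : ℤ :=
  if Even n then 2 * ⌊x / dx + 1 / 2⌋ else 2 * ⌊x / dx⌋ + 1

/-- The piecewise constant function of `(x, t)` attached to a grid function. It agrees with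
`approxSolution`, but is written so as to apply to arbitrary grid functions. -/
noncomputable def gridFun (dx dt : ℝ) (g : ℕ → ℤ → ℝ) (p : ℝ × ℝ) : ℝ :=
  g ⌊p.2 / dt⌋₊ (gridIndex dx ⌊p.2 / dt⌋₊ p.1)

theorem approxSolution_eq_gridFun (dx dt : ℝ) (U : ℕ → ℤ → ℝ) (x t : ℝ) :
    approxSolution dx dt U x t = gridFun dx dt U (x, t) := by
  simp only [approxSolution, gridFun, gridIndex]
  split_ifs <;> rfl

theorem even_gridIndex_add (dx : ℝ) (n : ℕ) (x : ℝ) : Even (gridIndex dx n x + (n : ℤ)) := by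
  unfold gridIndex
  split_ifs with h
  · exact (even_two_mul _).add (by exact_mod_cast h)
  · have : Odd (n : ℤ) := by exact_mod_cast Nat.not_even_iff_odd.mp h
    exact (odd_two_mul_add_one _).add_odd this

theorem gridFun_mem {dx dt : ℝ} {g : ℕ → ℤ → ℝ} {S : Set ℝ}
    (h : ∀ (n : ℕ) (i : ℤ), Even (i + (n : ℤ)) → g n i ∈ S) (p : ℝ × ℝ) :
    gridFun dx dt g p ∈ S :=
  h _ _ (even_gridIndex_add _ _ _)

theorem abs_gridFun_le {dx dt M : ℝ} {g : ℕ → ℤ → ℝ}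
    (h : ∀ (n : ℕ) (i : ℤ), Even (i + (n : ℤ)) → |g n i| ≤ M) (p : ℝ × ℝ) :
    |gridFun dx dt g p| ≤ M :=
  gridFun_mem (S := {r | |r| ≤ M}) h p

theorem gridFun_eq_of_mem_Ico {dx dt : ℝ} (g : ℕ → ℤ → ℝ) {p : ℝ × ℝ}
    (hp : p.2 ∈ Ico 0 dt) : gridFun dx dt g p = g 0 (gridIndex dx 0 p.1) := by
  have hfloor : ⌊p.2 / dt⌋₊ = 0 :=
    Nat.floor_eq_zero.2 ((div_lt_one (hp.1.trans_lt hp.2)).2 hp.2)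
  rw [gridFun, hfloor]

theorem measurable_gridFun (dx dt : ℝ) (g : ℕ → ℤ → ℝ) : Measurable (gridFun dx dt g) := by
  let G : ℕ × ℤ × ℤ → ℝ := fun z => g z.1 (if Even z.1 then 2 * z.2.1 else 2 * z.2.2 + 1)
  have hG : Measurable G := measurable_of_countable G
  have h : Measurable fun p : ℝ × ℝ => (⌊p.2 / dt⌋₊, ⌊p.1 / dx + 1 / 2⌋, ⌊p.1 / dx⌋) := by
    fun_prop
  exact hG.comp h

theorem mem_Ico_gridIndex {dx : ℝ} (hdx : 0 < dx) (n : ℕ) (x : ℝ) :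
    x ∈ Ico (((gridIndex dx n x : ℝ) - 1) * dx / 2) (((gridIndex dx n x : ℝ) + 1) * dx / 2) := by
  have hx : x / dx * dx = x := div_mul_cancel₀ x hdx.ne'
  unfold gridIndex
  split_ifs
  · have h₁ := Int.floor_le (x / dx + 1 / 2)
    have h₂ := Int.lt_floor_add_one (x / dx + 1 / 2)
    constructor <;> push_cast <;> nlinarith
  · have h₁ := Int.floor_le (x / dx)
    have h₂ := Int.lt_floor_add_one (x / dx)
    constructor <;> push_cast <;> nlinarith

theorem gridIndex_succ {dx : ℝ} (hdx : 0 < dx) (n : ℕ) (x : ℝ) :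
    gridIndex dx (n + 1) x = gridIndex dx n (x + dx / 2) - 1 := by
  have e : (x + dx / 2) / dx = x / dx + 1 / 2 := by field_simp
  rw [gridIndex, gridIndex, e, add_assoc, add_halves, Int.floor_add_one]
  by_cases h : Even n
  · simp only [h, Nat.even_add_one, not_true_eq_false, if_true, if_false]; ring
  · simp only [h, Nat.even_add_one, not_false_eq_true, if_true, if_false]; ring

theorem gridIndex_add_self {dx : ℝ} (hdx : 0 < dx) (n : ℕ) (x : ℝ) :
    gridIndex dx n (x + dx) = gridIndex dx n x + 2 := by
  rw [gridIndex, gridIndex, add_div, div_self hdx.ne', add_right_comm, Int.floor_add_one,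
    Int.floor_add_one]
  split_ifs <;> ring

theorem natFloor_add_self_div {dt t : ℝ} (hdt : 0 < dt) (ht : 0 ≤ t) :
    ⌊(t + dt) / dt⌋₊ = ⌊t / dt⌋₊ + 1 := by
  rw [add_div, div_self hdt.ne', Nat.floor_add_one (by positivity)]

/-- The two cells of level `n` below a cell of level `n + 1` are seen from its points by
translating half a mesh width to the left and to the right. -/
theorem exists_stencil {dx dt : ℝ} (hdx : 0 < dx) (hdt : 0 < dt) {p : ℝ × ℝ} (hp : 0 ≤ p.2) :
    ∃ (n : ℕ) (i : ℤ), Even (i + (n : ℤ)) ∧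
      p.2 ∈ Ico (n * dt) ((n + 1) * dt) ∧ p.1 ∈ Ico (i * dx / 2) ((i + 2) * dx / 2) ∧
      ∀ g : ℕ → ℤ → ℝ, gridFun dx dt g (p + (-(dx / 2), 0)) = g n i ∧
        gridFun dx dt g (p + (dx / 2, 0)) = g n (i + 2) ∧
        gridFun dx dt g (p + (0, dt)) = g (n + 1) (i + 1) := by
  obtain ⟨x, t⟩ := p
  set n := ⌊t / dt⌋₊
  set i := gridIndex dx n (x + -(dx / 2)) with hi
  have hright : gridIndex dx n (x + dx / 2) = i + 2 := by
    rw [hi, ← gridIndex_add_self hdx]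
    ring_nf
  have hx := mem_Ico_gridIndex hdx n (x + -(dx / 2))
  rw [← hi] at hx
  refine ⟨n, i, even_gridIndex_add _ _ _, ⟨?_, ?_⟩, ⟨?_, ?_⟩, fun g => ⟨?_, ?_, ?_⟩⟩
  · exact (le_div_iff₀ hdt).1 (Nat.floor_le (div_nonneg hp hdt.le))
  · exact (div_lt_iff₀ hdt).1 (Nat.lt_floor_add_one _)
  · linarith [hx.1]
  · linarith [hx.2]
  · simp only [gridFun, Prod.mk_add_mk, add_zero, hi, n]
  · simp only [gridFun, Prod.mk_add_mk, add_zero, n, ← hright]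
  · simp only [gridFun, Prod.mk_add_mk, add_zero, natFloor_add_self_div hdt hp,
      gridIndex_succ hdx, n, hright]
    ring_nf

theorem cellAverage_eq_setAverage {g : ℝ → ℝ} {dx : ℝ} (hdx : 0 < dx) (i : ℤ) :
    cellAverage g dx i = ⨍ x in Metric.closedBall ((i : ℝ) * dx / 2) (dx / 2), g x := by
  have hleft : ((i : ℝ) - 1) * dx / 2 = (i : ℝ) * dx / 2 - dx / 2 := by ring
  have hright : ((i : ℝ) + 1) * dx / 2 = (i : ℝ) * dx / 2 + dx / 2 := by ring
  have hvol : max ((i : ℝ) * dx / 2 + dx / 2 - ((i : ℝ) * dx / 2 - dx / 2)) 0 = dx := by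
    rw [max_eq_left] <;> linarith
  rw [setAverage_eq, Real.closedBall_eq_Icc, integral_Icc_eq_integral_Ioc, cellAverage,
    intervalIntegral.integral_of_le (by nlinarith), hleft, hright, Real.volume_real_Icc, hvol,
    smul_eq_mul, one_div]

theorem ae_tendsto_cellAverage {g : ℝ → ℝ} (hg : LocallyIntegrable g) {dx : ℕ → ℝ}
    (hpos : ∀ m, 0 < dx m) (hdx : Tendsto dx atTop (𝓝 0)) :
    ∀ᵐ x : ℝ, ∀ n : ℕ → ℕ,
      Tendsto (fun m => cellAverage g (dx m) (gridIndex (dx m) (n m) x)) atTop (𝓝 (g x)) := by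
  filter_upwards [IsUnifLocDoublingMeasure.ae_tendsto_average volume hg 1] with x hx n
  refine (hx (l := atTop) (fun m => (gridIndex (dx m) (n m) x : ℝ) * dx m / 2)
    (fun m => dx m / 2) ?_ (Eventually.of_forall fun m => ?_)).congr
    fun m => (cellAverage_eq_setAverage (hpos m) _).symm
  · exact tendsto_nhdsWithin_iff.2
      ⟨by simpa using hdx.div_const 2, Eventually.of_forall fun m => half_pos (hpos m)⟩
  · have := mem_Ico_gridIndex (hpos m) (n m) x
    rw [Real.closedBall_eq_Icc]
    constructor <;> linarith [this.1, this.2]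

theorem cellAverage_mem {g : ℝ → ℝ} {dx : ℝ} {S : Set ℝ} (hdx : 0 < dx)
    (hg : LocallyIntegrable g) (hS : Convex ℝ S) (hSc : IsClosed S) (h : ∀ᵐ x, g x ∈ S)
    (i : ℤ) : cellAverage g dx i ∈ S := by
  rw [cellAverage_eq_setAverage hdx]
  exact hS.set_average_mem hSc (Metric.measure_closedBall_pos _ _ (half_pos hdx)).ne'
    measure_closedBall_lt_top.ne (ae_restrict_of_ae h)
    (hg.integrableOn_isCompact (isCompact_closedBall _ _))

theorem locallyIntegrable_of_ae_mem_Icc {g : ℝ → ℝ} {a b : ℝ} (hg : AEStronglyMeasurable g)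
    (h : ∀ᵐ x, g x ∈ Icc a b) : LocallyIntegrable g := by
  refine (locallyIntegrable_const (max |a| |b|)).mono hg ?_
  filter_upwards [h] with x hx
  simp only [Real.norm_eq_abs]
  exact (abs_le_max_abs_abs hx.1 hx.2).trans (le_abs_self _)

theorem cellAverage_add_two_sub {g : ℝ → ℝ} (hg : LocallyIntegrable g) (dx : ℝ) (i : ℤ) :
    cellAverage g dx (i + 2) - cellAverage g dx i =
      1 / dx * ∫ x in (((i : ℝ) - 1) * dx / 2)..(((i : ℝ) + 1) * dx / 2), (g (x + dx) - g x) := by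
  have hint (a b : ℝ) : IntervalIntegrable g volume a b :=
    (hg.integrableOn_isCompact isCompact_uIcc).intervalIntegrable
  rw [intervalIntegral.integral_sub _ (hint _ _), intervalIntegral.integral_comp_add_right g,
    cellAverage, cellAverage, ← mul_sub]
  · push_cast
    ring_nf
  · simpa using (hint (((i : ℝ) - 1) * dx / 2 + dx) (((i : ℝ) + 1) * dx / 2 + dx)).comp_add_right dx

theorem abs_cellAverage_add_two_sub_le {k V : ℝ → ℝ} {dx : ℝ} (hdx : 0 < dx)
    (hk : LocallyIntegrable k) (hV : LocallyIntegrable V)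
    (h : ∀ᵐ x, |k (x + dx) - k x| ≤ V (x + dx) - V x) (i : ℤ) :
    |cellAverage k dx (i + 2) - cellAverage k dx i| ≤
      cellAverage V dx (i + 2) - cellAverage V dx i := by
  have hint : IntervalIntegrable (fun x => V (x + dx) - V x) volume
      (((i : ℝ) - 1) * dx / 2) (((i : ℝ) + 1) * dx / 2) := by
    have hV' (a b : ℝ) : IntervalIntegrable V volume a b :=
      (hV.integrableOn_isCompact isCompact_uIcc).intervalIntegrable
    refine IntervalIntegrable.sub ?_ (hV' _ _)
    simpa using (hV' (((i : ℝ) - 1) * dx / 2 + dx) (((i : ℝ) + 1) * dx / 2 + dx)).comp_add_right dx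
  rw [cellAverage_add_two_sub hk, cellAverage_add_two_sub hV, abs_mul,
    abs_of_pos (one_div_pos.2 hdx)]
  gcongr
  rw [← Real.norm_eq_abs]
  exact intervalIntegral.norm_integral_le_of_norm_le (by nlinarith)
    (h.mono fun x hx _ => hx) hint

/-- The left-continuous step function with a jump of height `h y` at each point `y` of `D`. -/
noncomputable def jumpSum (D : Finset ℝ) (h : ℝ → ℝ) (x : ℝ) : ℝ :=
  ∑ y ∈ D, if y < x then h y else 0

theorem jumpSum_sub (D : Finset ℝ) (h : ℝ → ℝ) {a b : ℝ} (hab : a ≤ b) :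
    jumpSum D h b - jumpSum D h a = ∑ y ∈ D, if a ≤ y ∧ y < b then h y else 0 := by
  rw [jumpSum, jumpSum, ← Finset.sum_sub_distrib]
  refine Finset.sum_congr rfl fun y _ => ?_
  rcases lt_or_ge y a with hya | hya
  · simp [hya, hya.trans_le hab, not_le.2 hya]
  · simp [hya, not_lt.2 hya]

theorem abs_jumpSum_sub_le (D : Finset ℝ) (h : ℝ → ℝ) {a b : ℝ} (hab : a ≤ b) :
    |jumpSum D h b - jumpSum D h a| ≤ jumpSum D (|h ·|) b - jumpSum D (|h ·|) a := by
  rw [jumpSum_sub D h hab, jumpSum_sub D _ hab]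
  refine (Finset.abs_sum_le_sum_abs _ _).trans_eq (Finset.sum_congr rfl fun y _ => ?_)
  split_ifs <;> simp

theorem abs_jumpSum_le (D : Finset ℝ) (h : ℝ → ℝ) (x : ℝ) : |jumpSum D h x| ≤ ∑ y ∈ D, |h y| := by
  refine (Finset.abs_sum_le_sum_abs _ _).trans (Finset.sum_le_sum fun y _ => ?_)
  split_ifs <;> simp

theorem eventually_jumpSum_eq (D : Finset ℝ) (h : ℝ → ℝ) (x : ℝ) :
    ∀ᶠ z in 𝓝 x, jumpSum D h z = jumpSum D h x + if x ∈ D ∧ x < z then h x else 0 := by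
  have hev : ∀ᶠ z in 𝓝 x, ∀ y ∈ D, y ≠ x → (y < z ↔ y < x) :=
    (eventually_all_finset D).2 fun y _ => by
      rcases lt_trichotomy y x with hy | hy | hy
      · filter_upwards [lt_mem_nhds hy] with z hz _ using iff_of_true hz hy
      · exact Eventually.of_forall fun z hne => absurd hy hne
      · filter_upwards [gt_mem_nhds hy] with z hz _ using iff_of_false hz.not_gt hy.not_gt
  filter_upwards [hev] with z hz
  have hterm (y : ℝ) (hy : y ∈ D) : (if y < z then h y else 0) =
      (if y < x then h y else 0) + if y = x then (if x < z then h x else 0) else 0 := by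
    rcases eq_or_ne y x with rfl | hne
    · simp
    · simp [hne, hz y hy hne]
  rw [jumpSum, Finset.sum_congr rfl hterm, Finset.sum_add_distrib, Finset.sum_ite_eq', ite_and,
    jumpSum]

/-- The height of the jump of `k` at `y`. -/
noncomputable def jumpAt (k : ℝ → ℝ) (y : ℝ) : ℝ :=
  Function.rightLim k y - Function.leftLim k y

/-- A distribution function of the total variation of `k`, as the sum of its absolutely continuous
part and its jumps; a change of the values of `k` on `D` does not affect it. -/
noncomputable def variationFun (k : ℝ → ℝ) (D : Finset ℝ) (x : ℝ) : ℝ :=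
  (∫ t in (0)..x, |deriv k t|) + jumpSum D (|jumpAt k ·|) x

/-- The continuous part of `k`: its left-continuous representative without the jumps, which occur
at points of `D`. -/
noncomputable def jumpFree (k : ℝ → ℝ) (D : Finset ℝ) (x : ℝ) : ℝ :=
  Function.leftLim k x - jumpSum D (jumpAt k) x

theorem integrable_deriv_of_monotone {g : ℝ → ℝ} {C : ℝ} (hg : Monotone g) (hC : ∀ x, |g x| ≤ C) :
    Integrable (deriv g) := by
  have hmono (a b : ℝ) : MonotoneOn g (uIcc a b) := hg.monotoneOn _
  refine integrable_of_intervalIntegral_norm_bounded (l := atTop) (2 * C) (a := fun R => -R)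
    (b := fun R => R) (fun R => ((hmono _ _).intervalIntegrable_deriv).1) tendsto_neg_atTop_atBot
    tendsto_id ?_
  filter_upwards [eventually_ge_atTop 0] with R hR
  have hle := (hmono (-R) R).intervalIntegral_deriv_mem_uIcc
  rw [uIcc_of_le (sub_nonneg.2 (hg (by linarith)))] at hle
  simp_rw [Real.norm_eq_abs, abs_of_nonneg (hg.deriv_nonneg)]
  linarith [hle.2, abs_le.1 (hC R), abs_le.1 (hC (-R))]

theorem integrable_deriv_of_boundedVariationOn {k : ℝ → ℝ} (hk : BoundedVariationOn k univ) :
    Integrable (deriv k) := by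
  set v : ℝ → ℝ := variationOnFromTo k univ 0
  have hlb := hk.locallyBoundedVariationOn
  have hv : Monotone v := monotoneOn_univ.1 (variationOnFromTo.monotoneOn hlb (mem_univ 0))
  have hvk : Monotone (v - k) :=
    monotoneOn_univ.1 (variationOnFromTo.sub_self_monotoneOn hlb (mem_univ 0))
  have hv_le (x : ℝ) : |v x| ≤ (eVariationOn k univ).toReal :=
    variationOnFromTo.abs_le_eVariationOn hk
  have hk_le (x : ℝ) : |k x| ≤ |k 0| + (eVariationOn k univ).toReal := by
    have := hk.dist_le (mem_univ x) (mem_univ 0)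
    rw [Real.dist_eq] at this
    linarith [abs_sub_abs_le_abs_sub (k x) (k 0)]
  have hvk_le (x : ℝ) : |(v - k) x| ≤ |k 0| + 2 * (eVariationOn k univ).toReal :=
    (abs_sub _ _).trans (by linarith [hv_le x, hk_le x])
  refine ((integrable_deriv_of_monotone hv hv_le).sub
    (integrable_deriv_of_monotone hvk hvk_le)).congr ?_
  filter_upwards [hv.ae_differentiableAt, hvk.ae_differentiableAt] with x hx hx'
  rw [Pi.sub_apply, ← deriv_sub hx hx', sub_sub_cancel]

section BoundedVariation

variable {k : ℝ → ℝ} {D : Finset ℝ} {P : Set ℝ}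

theorem variationFun_sub (hk : BoundedVariationOn k univ) (a b : ℝ) :
    variationFun k D b - variationFun k D a = (∫ t in a..b, |deriv k t|) +
      (jumpSum D (|jumpAt k ·|) b - jumpSum D (|jumpAt k ·|) a) := by
  have hint (c d : ℝ) : IntervalIntegrable (fun t => |deriv k t|) volume c d :=
    (integrable_deriv_of_boundedVariationOn hk).abs.intervalIntegrable
  rw [variationFun, variationFun,
    ← intervalIntegral.integral_interval_sub_left (hint 0 b) (hint 0 a)]
  ring

theorem exists_abs_variationFun_le (hk : BoundedVariationOn k univ) (D : Finset ℝ) :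
    ∃ M, ∀ x, |variationFun k D x| ≤ M := by
  have hint := (integrable_deriv_of_boundedVariationOn hk).abs
  refine ⟨(∫ t, |deriv k t|) + ∑ y ∈ D, |(|jumpAt k y|)|, fun x =>
    (abs_add_le _ _).trans (add_le_add ?_ (abs_jumpSum_le _ _ _))⟩
  rw [← Real.norm_eq_abs]
  refine intervalIntegral.norm_integral_le_integral_norm_uIoc.trans ?_
  simp_rw [Real.norm_eq_abs, abs_abs]
  exact setIntegral_le_integral hint (Eventually.of_forall fun t => abs_nonneg _)

theorem leftLim_eventuallyEq_nhdsNE (hD : ∀ x ∉ D, ContinuousAt k x) (x : ℝ) :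
    Function.leftLim k =ᶠ[𝓝[≠] x] k := by
  have hclosed : IsClosed ((D : Set ℝ) \ {x}) := (D.finite_toSet.subset sdiff_subset).isClosed
  filter_upwards [self_mem_nhdsWithin,
    nhdsWithin_le_nhds (hclosed.isOpen_compl.mem_nhds (by simp))] with z hzx hz
  exact (hD z fun hzD => hz ⟨hzD, hzx⟩).continuousWithinAt.leftLim_eq

theorem continuous_jumpFree (hk : BoundedVariationOn k univ) (hD : ∀ x ∉ D, ContinuousAt k x) :
    Continuous (jumpFree k D) := by
  refine continuous_iff_continuousAt.2 fun x =>
    continuousAt_iff_continuous_left'_right'.2 ⟨?_, ?_⟩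
  · have hlim : Tendsto (Function.leftLim k) (𝓝[<] x) (𝓝 (Function.leftLim k x)) :=
      hk.continuousWithinAt_leftLim.mono Iio_subset_Iic_self
    refine (hlim.sub_const (jumpSum D (jumpAt k) x)).congr' ?_
    filter_upwards [self_mem_nhdsWithin,
      nhdsWithin_le_nhds (eventually_jumpSum_eq D (jumpAt k) x)] with z hzx hz
    simp only [jumpFree, hz, not_lt_of_gt (mem_Iio.1 hzx), and_false, if_false, add_zero]
  · have hlim : Tendsto (Function.leftLim k) (𝓝[>] x) (𝓝 (Function.rightLim k x)) :=
      (hk.tendsto_rightLim x).congr'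
        ((leftLim_eventuallyEq_nhdsNE hD x).filter_mono (nhdsGT_le_nhdsNE x)).symm
    have hval : jumpFree k D x = Function.rightLim k x -
        (jumpSum D (jumpAt k) x + if x ∈ D then jumpAt k x else 0) := by
      split_ifs with hx
      · rw [jumpFree, jumpAt]; ring
      · rw [jumpFree, (hD x hx).continuousWithinAt.leftLim_eq,
          (hD x hx).continuousWithinAt.rightLim_eq, add_zero]
    rw [ContinuousWithinAt, hval]
    refine (hlim.sub_const _).congr' ?_
    filter_upwards [self_mem_nhdsWithin,
      nhdsWithin_le_nhds (eventually_jumpSum_eq D (jumpAt k) x)] with z hzx hz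
    simp only [jumpFree, hz, mem_Ioi.1 hzx, and_true]

theorem hasDerivAt_jumpFree (hD : ∀ x ∉ D, ContinuousAt k x) {x : ℝ}
    (hx : DifferentiableAt ℝ k x) : HasDerivAt (jumpFree k D) (deriv k x) x := by
  have hleft : Function.leftLim k x = k x := hx.continuousAt.continuousWithinAt.leftLim_eq
  have hjump : jumpAt k x = 0 := by
    rw [jumpAt, hleft, hx.continuousAt.continuousWithinAt.rightLim_eq, sub_self]
  refine (hx.hasDerivAt.sub_const (jumpSum D (jumpAt k) x)).congr_of_eventuallyEq ?_
  filter_upwards [eventually_jumpSum_eq D (jumpAt k) x,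
    eventually_nhdsWithin_iff.1 (leftLim_eventuallyEq_nhdsNE hD x)] with z hz hzk
  rcases eq_or_ne z x with rfl | hne
  · rw [jumpFree, hleft]
  · rw [jumpFree, hz, hzk hne, hjump, ite_self, add_zero]

theorem abs_leftLim_sub_le_variationFun (hk : BoundedVariationOn k univ)
    (hD : ∀ x ∉ D, ContinuousAt k x) (hP : P.Countable) (hkP : ∀ x ∉ P, DifferentiableAt ℝ k x)
    {a b : ℝ} (hab : a ≤ b) :
    |Function.leftLim k b - Function.leftLim k a| ≤ variationFun k D b - variationFun k D a := by
  have hftc : ∫ t in a..b, deriv k t = jumpFree k D b - jumpFree k D a :=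
    integral_eq_of_hasDerivAt_off_countable _ _ hP (continuous_jumpFree hk hD).continuousOn
      (fun x hx => hasDerivAt_jumpFree hD (hkP x hx.2))
      (integrable_deriv_of_boundedVariationOn hk).intervalIntegrable
  have hsplit : Function.leftLim k b - Function.leftLim k a = (∫ t in a..b, deriv k t) +
      (jumpSum D (jumpAt k) b - jumpSum D (jumpAt k) a) := by
    rw [hftc, jumpFree, jumpFree]; ring
  rw [hsplit, variationFun_sub hk]
  exact (abs_add_le _ _).trans (add_le_add (intervalIntegral.abs_integral_le_integral_abs hab)
    (abs_jumpSum_sub_le _ _ hab))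

theorem measurable_variationFun (hk : BoundedVariationOn k univ) (D : Finset ℝ) :
    Measurable (variationFun k D) := by
  have hcont : Continuous fun x => ∫ t in (0)..x, |deriv k t| :=
    intervalIntegral.continuous_primitive
      (fun _ _ => (integrable_deriv_of_boundedVariationOn hk).abs.intervalIntegrable) 0
  exact hcont.measurable.add (Finset.measurable_fun_sum _ fun y _ =>
    Measurable.ite measurableSet_Ioi measurable_const measurable_const)

end BoundedVariation

theorem integral_primitive_mul_deriv {g ψ : ℝ → ℝ} (hg : Integrable g) (hψ : ContDiff ℝ 1 ψ)
    (hψc : HasCompactSupport ψ) :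
    ∫ x, (∫ t in (0)..x, g t) * deriv ψ x = -∫ x, g x * ψ x := by
  obtain ⟨R, hR, hψR⟩ := hψc.isCompact.isBounded.subset_ball_lt 0 0
  rw [Real.ball_eq_Ioo, zero_sub, zero_add] at hψR
  have hprim : AbsolutelyContinuousOnInterval (fun x => ∫ t in (0)..x, g t) (-R) R :=
    hg.intervalIntegrable.absolutelyContinuousOnInterval_intervalIntegral
      (by rw [uIcc_of_le (by linarith)]; constructor <;> linarith)
  have hderiv : ∀ᵐ x, deriv (fun x => ∫ t in (0)..x, g t) x = g x := by
    filter_upwards [LocallyIntegrable.ae_hasDerivAt_integral hg.locallyIntegrable] with x hx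
    exact (hx 0).deriv
  have hzero (x : ℝ) (hx : x ∉ Ioo (-R) R) : ψ x = 0 :=
    Function.notMem_support.1 fun h => hx (hψR (subset_tsupport ψ h))
  calc ∫ x, (∫ t in (0)..x, g t) * deriv ψ x
      = ∫ x in (-R)..R, (∫ t in (0)..x, g t) * deriv ψ x := by
        refine (intervalIntegral.integral_eq_integral_of_support_subset fun x hx => ?_).symm
        exact Ioo_subset_Ioc_self (hψR (support_deriv_subset (right_ne_zero_of_mul hx)))
    _ = -∫ x in (-R)..R, deriv (fun x => ∫ t in (0)..x, g t) x * ψ x := by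
        rw [hprim.integral_mul_deriv_eq_deriv_mul hψ.contDiffOn.absolutelyContinuousOnInterval,
          hzero R (by simp), hzero (-R) (by simp)]
        ring
    _ = -∫ x in (-R)..R, g x * ψ x := by
        rw [intervalIntegral.integral_congr_ae (hderiv.mono fun x hx _ => by rw [hx])]
    _ = -∫ x, g x * ψ x := by
        rw [intervalIntegral.integral_eq_integral_of_support_subset fun x hx => ?_]
        exact Ioo_subset_Ioc_self (hψR (subset_tsupport ψ (right_ne_zero_of_mul hx)))

theorem integral_jumpSum_mul_deriv (D : Finset ℝ) (h : ℝ → ℝ) {ψ : ℝ → ℝ} (hψ : ContDiff ℝ 1 ψ)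
    (hψc : HasCompactSupport ψ) :
    ∫ x, jumpSum D h x * deriv ψ x = -∑ y ∈ D, h y * ψ y := by
  have hind (y x : ℝ) : (if y < x then h y else 0) * deriv ψ x =
      (Ioi y).indicator (fun x => h y * deriv ψ x) x := by
    rw [indicator_apply, ite_mul, zero_mul]; rfl
  have hint : Integrable (deriv ψ) :=
    (hψ.continuous_deriv le_rfl).integrable_of_hasCompactSupport hψc.deriv
  simp_rw [jumpSum, Finset.sum_mul, hind]
  rw [integral_finsetSum _ fun y _ => (hint.const_mul _).indicator measurableSet_Ioi,
    ← Finset.sum_neg_distrib]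
  refine Finset.sum_congr rfl fun y _ => ?_
  rw [integral_indicator measurableSet_Ioi, integral_const_mul, hψc.integral_Ioi_deriv_eq hψ,
    mul_neg]

theorem integral_variationFun_mul_deriv {k ψ : ℝ → ℝ} (hk : BoundedVariationOn k univ)
    (D : Finset ℝ) (hψ : ContDiff ℝ 1 ψ) (hψc : HasCompactSupport ψ) :
    ∫ x, variationFun k D x * deriv ψ x =
      -((∫ x, |deriv k x| * ψ x) + ∑ y ∈ D, |jumpAt k y| * ψ y) := by
  have hg := (integrable_deriv_of_boundedVariationOn hk).abs
  have hdψ : Integrable (deriv ψ) :=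
    (hψ.continuous_deriv le_rfl).integrable_of_hasCompactSupport hψc.deriv
  have hprim : Integrable fun x => (∫ t in (0)..x, |deriv k t|) * deriv ψ x :=
    ((intervalIntegral.continuous_primitive (fun _ _ => hg.intervalIntegrable) 0).mul
      (hψ.continuous_deriv le_rfl)).integrable_of_hasCompactSupport hψc.deriv.mul_left
  have hjump : Integrable fun x => jumpSum D (|jumpAt k ·|) x * deriv ψ x :=
    hdψ.bdd_mul (Finset.measurable_fun_sum _ fun y _ =>
      Measurable.ite measurableSet_Ioi measurable_const measurable_const).aestronglyMeasurable
      (Eventually.of_forall (abs_jumpSum_le D _))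
  simp_rw [variationFun, add_mul]
  rw [integral_add hprim hjump, integral_primitive_mul_deriv hg hψ hψc,
    integral_jumpSum_mul_deriv D _ hψ hψc, neg_add]

/-- The closed half plane `t ≥ 0` in the `(x, t)` plane. -/
abbrev halfPlane : Set (ℝ × ℝ) := {p | 0 ≤ p.2}

theorem restrict_halfPlane_eq_prod :
    (volume : Measure (ℝ × ℝ)).restrict halfPlane =
      (volume : Measure ℝ).prod (volume.restrict (Ici 0)) := by
  have hset : halfPlane = univ ×ˢ Ici 0 := by ext p; simp
  rw [hset, Measure.volume_eq_prod, ← Measure.prod_restrict, Measure.restrict_univ]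

theorem measurableSet_le_snd (r : ℝ) : MeasurableSet {p : ℝ × ℝ | r ≤ p.2} :=
  measurableSet_le measurable_const measurable_snd

theorem setIntegral_halfPlane_comp_add (g : ℝ × ℝ → ℝ) (s r : ℝ) :
    ∫ p in halfPlane, g (p + (s, r)) = ∫ p in {p : ℝ × ℝ | r ≤ p.2}, g p := by
  rw [← integral_indicator (measurableSet_le_snd 0), ← integral_indicator (measurableSet_le_snd r),
    ← integral_add_right_eq_self (indicator {p : ℝ × ℝ | r ≤ p.2} g) ((s, r) : ℝ × ℝ)]
  congr 1
  ext p
  simp only [indicator, mem_ofPred_eq, Prod.snd_add, le_add_iff_nonneg_left]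

theorem hasCompactSupport_slice_left {X Y : Type*} [TopologicalSpace X] [R1Space X]
    [TopologicalSpace Y] {φ : X × Y → ℝ} (hφc : HasCompactSupport φ) (y : Y) :
    HasCompactSupport fun x => φ (x, y) :=
  HasCompactSupport.intro (hφc.isCompact.image continuous_fst) fun _ hx =>
    image_eq_zero_of_notMem_tsupport fun h => hx ⟨_, h, rfl⟩

theorem hasCompactSupport_slice_right {X Y : Type*} [TopologicalSpace X]
    [TopologicalSpace Y] [R1Space Y] {φ : X × Y → ℝ} (hφc : HasCompactSupport φ) (x : X) :
    HasCompactSupport fun y => φ (x, y) :=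
  HasCompactSupport.intro (hφc.isCompact.image continuous_snd) fun _ hy =>
    image_eq_zero_of_notMem_tsupport fun h => hy ⟨_, h, rfl⟩

theorem integrable_fst_mul_of_hasCompactSupport {g : ℝ → ℝ} {φ : ℝ × ℝ → ℝ} (hg : Integrable g)
    (hφ : Continuous φ) (hφc : HasCompactSupport φ) : Integrable fun p : ℝ × ℝ => g p.1 * φ p := by
  set T : Set ℝ := Prod.snd '' tsupport φ
  have hT : IsCompact T := hφc.isCompact.image continuous_snd
  obtain ⟨B, hB⟩ := hφc.exists_bound_of_continuous hφ
  have hT_int : Integrable (T.indicator fun _ : ℝ => (1 : ℝ)) :=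
    (integrable_indicator_iff hT.measurableSet).2 (integrableOn_const hT.measure_lt_top.ne)
  have hint := (hg.mul_prod hT_int).bdd_mul hφ.aestronglyMeasurable (Eventually.of_forall hB)
  refine hint.congr (Eventually.of_forall fun p => ?_)
  by_cases hp : p.2 ∈ T
  · simp only [indicator_of_mem hp]; ring
  · have : φ p = 0 := image_eq_zero_of_notMem_tsupport fun h => hp ⟨p, h, rfl⟩
    simp only [this]; ring

theorem hasDerivAt_slice_left {φ : ℝ × ℝ → ℝ} (hφ : ContDiff ℝ 1 φ) (p : ℝ × ℝ) :
    HasDerivAt (fun x => φ (x, p.2)) (fderiv ℝ φ p (1, 0)) p.1 :=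
  (hφ.differentiable one_ne_zero p).hasFDerivAt.comp_hasDerivAt p.1
    ((hasDerivAt_id p.1).prodMk (hasDerivAt_const p.1 p.2))

theorem hasDerivAt_slice_right {φ : ℝ × ℝ → ℝ} (hφ : ContDiff ℝ 1 φ) (p : ℝ × ℝ) :
    HasDerivAt (fun t => φ (p.1, t)) (fderiv ℝ φ p (0, 1)) p.2 :=
  (hφ.differentiable one_ne_zero p).hasFDerivAt.comp_hasDerivAt p.2
    ((hasDerivAt_const p.2 p.1).prodMk (hasDerivAt_id p.2))

theorem setIntegral_variationFun_mul_fderiv {k : ℝ → ℝ} (hk : BoundedVariationOn k univ)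
    (D : Finset ℝ) {φ : ℝ × ℝ → ℝ} (hφ : ContDiff ℝ 1 φ) (hφc : HasCompactSupport φ) :
    ∫ p in halfPlane, variationFun k D p.1 * fderiv ℝ φ p (1, 0) =
      -((∫ p in halfPlane, |deriv k p.1| * φ p) +
        ∑ y ∈ D, ∫ t in Ici (0 : ℝ), |jumpAt k y| * φ (y, t)) := by
  obtain ⟨M, hM⟩ := exists_abs_variationFun_le hk D
  have hV : IntegrableOn (fun p => variationFun k D p.1 * fderiv ℝ φ p (1, 0)) halfPlane :=
    ((((hφ.continuous_fderiv one_ne_zero).clm_apply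
      continuous_const).integrable_of_hasCompactSupport (hφc.fderiv_apply ℝ _)).bdd_mul
      ((measurable_variationFun hk D).comp measurable_fst).aestronglyMeasurable
      (Eventually.of_forall fun p => hM p.1)).integrableOn
  have hk' : IntegrableOn (fun p => |deriv k p.1| * φ p) halfPlane :=
    (integrable_fst_mul_of_hasCompactSupport (integrable_deriv_of_boundedVariationOn hk).abs
      hφ.continuous hφc).integrableOn
  have hjump (y : ℝ) (_ : y ∈ D) : IntegrableOn (fun t => |jumpAt k y| * φ (y, t)) (Ici 0) :=
    (((hφ.continuous.comp (by fun_prop)).integrable_of_hasCompactSupport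
      (hasCompactSupport_slice_right hφc y)).const_mul _).integrableOn
  unfold IntegrableOn at hV hk'
  rw [restrict_halfPlane_eq_prod] at hV hk' ⊢
  rw [integral_prod_symm _ hV, integral_prod_symm _ hk', ← integral_finsetSum _ hjump,
    ← integral_add hk'.integral_prod_right (integrable_finsetSum _ hjump), ← integral_neg]
  refine integral_congr_ae (Eventually.of_forall fun t => ?_)
  have hslice : ContDiff ℝ 1 fun x => φ (x, t) := hφ.comp (contDiff_id.prodMk contDiff_const)
  simpa only [(hasDerivAt_slice_left hφ (_, t)).deriv] using
    integral_variationFun_mul_deriv hk D hslice (hasCompactSupport_slice_left hφc t)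

theorem exists_abs_add_smul_sub_le {E : Type*} [NormedAddCommGroup E] [NormedSpace ℝ E] {φ : E → ℝ}
    (hφ : ContDiff ℝ 1 φ) (hφc : HasCompactSupport φ) (H : ℝ) (v : E) :
    ∃ (C : ℝ) (R : ℝ), ∀ r : ℝ, 0 ≤ r → r ≤ H → ∀ p,
      |φ (p + r • v) - φ p| ≤ r * (Metric.closedBall (0 : E) R).indicator (fun _ => C) p := by
  obtain ⟨L, hL⟩ := hφ.lipschitzWith_of_hasCompactSupport hφc one_ne_zero
  obtain ⟨R, hR⟩ := hφc.isCompact.isBounded.subset_closedBall (0 : E)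
  have hzero (p : E) (hp : R < ‖p‖) : φ p = 0 :=
    image_eq_zero_of_notMem_tsupport fun h => hp.not_ge (mem_closedBall_zero_iff.1 (hR h))
  refine ⟨L * ‖v‖, R + H * ‖v‖, fun r hr hrH p => ?_⟩
  by_cases hp : p ∈ Metric.closedBall (0 : E) (R + H * ‖v‖)
  · rw [indicator_of_mem hp]
    refine (hL.norm_sub_le _ _).trans_eq ?_
    rw [add_sub_cancel_left, norm_smul, Real.norm_of_nonneg hr]
    ring
  · rw [indicator_of_notMem hp, mul_zero]
    rw [mem_closedBall_zero_iff, not_le] at hp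
    have hmono : r * ‖v‖ ≤ H * ‖v‖ := mul_le_mul_of_nonneg_right hrH (norm_nonneg v)
    have hpr : ‖p‖ - r * ‖v‖ ≤ ‖p + r • v‖ := by
      simpa [norm_smul, abs_of_nonneg hr] using norm_sub_le_norm_add p (r • v)
    rw [hzero _ (by linarith), hzero p (by linarith [mul_nonneg hr (norm_nonneg v)]), sub_self,
      abs_zero]

theorem tendsto_integral_mul_differenceQuotient {E : Type*} [NormedAddCommGroup E]
    [NormedSpace ℝ E] [ProperSpace E] [MeasurableSpace E] [BorelSpace E] {μ : Measure E}
    [IsFiniteMeasureOnCompacts μ] {φ : E → ℝ} {h : ℕ → ℝ} {g : ℕ → E → ℝ} {g₀ : E → ℝ} {M : ℝ}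
    (hφ : ContDiff ℝ 1 φ) (hφc : HasCompactSupport φ) (hpos : ∀ m, 0 < h m)
    (hh : Tendsto h atTop (𝓝 0)) (hg : ∀ m, AEStronglyMeasurable (g m) μ)
    (hM : ∀ m p, |g m p| ≤ M)
    (hlim : ∀ᵐ p ∂μ, Tendsto (fun m => g m p) atTop (𝓝 (g₀ p))) (v : E) :
    Tendsto (fun m => (h m)⁻¹ * ∫ p, g m p * (φ (p + h m • v) - φ p) ∂μ) atTop
      (𝓝 (∫ p, g₀ p * fderiv ℝ φ p v ∂μ)) := by
  obtain ⟨H, hH⟩ := hh.bddAbove_range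
  obtain ⟨C, R, hCR⟩ := exists_abs_add_smul_sub_le hφ hφc H v
  simp_rw [← integral_const_mul]
  refine tendsto_integral_of_dominated_convergence
    (fun p => M * (Metric.closedBall (0 : E) R).indicator (fun _ => C) p) (fun m => ?_) ?_
    (fun m => Eventually.of_forall fun p => ?_) ?_
  · have hφm : Continuous fun p => φ (p + h m • v) - φ p :=
      (hφ.continuous.comp (continuous_add_const _)).sub hφ.continuous
    exact ((hg m).mul hφm.aestronglyMeasurable).const_mul _
  · exact ((integrable_indicator_iff Metric.isClosed_closedBall.measurableSet).2
      (integrableOn_const (isCompact_closedBall _ _).measure_lt_top.ne)).const_mul M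
  · rw [Real.norm_eq_abs, mul_left_comm, abs_mul, abs_mul, abs_of_pos (inv_pos.2 (hpos m))]
    refine mul_le_mul (hM m p) ?_ (by have := hpos m; positivity) ((abs_nonneg _).trans (hM m p))
    rw [inv_mul_le_iff₀ (hpos m)]
    exact hCR _ (hpos m).le (hH (mem_range_self m)) p
  · filter_upwards [hlim] with p hp
    have hslope : Tendsto (fun m => (h m)⁻¹ • (φ (p + h m • v) - φ p)) atTop
        (𝓝 (fderiv ℝ φ p v)) :=
      (((hφ.differentiable one_ne_zero p).hasFDerivAt.hasLineDerivAt v).tendsto_slope_zero).comp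
        (tendsto_nhdsWithin_iff.2 ⟨hh, Eventually.of_forall fun m => (hpos m).ne'⟩)
    refine (hp.mul hslope).congr fun m => ?_
    rw [smul_eq_mul, mul_left_comm]

/-- The mean of `g` over `[c, c + ε]`. -/
noncomputable def forwardMean (c ε : ℝ) (g : ℝ → ℝ) : ℝ :=
  ε⁻¹ * ∫ s in c..(c + ε), g s

theorem abs_forwardMean_le {c ε C : ℝ} (hε : 0 < ε) {g : ℝ → ℝ}
    (h : ∀ s ∈ Icc c (c + ε), |g s| ≤ C) : |forwardMean c ε g| ≤ C := by
  rw [forwardMean, abs_mul, abs_of_pos (inv_pos.2 hε), inv_mul_le_iff₀ hε, mul_comm,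
    ← Real.norm_eq_abs]
  refine (intervalIntegral.norm_integral_le_of_norm_le_const fun s hs => ?_).trans_eq
    (by rw [add_sub_cancel_left, abs_of_pos hε])
  rw [uIoc_of_le (by linarith)] at hs
  exact h s (Ioc_subset_Icc_self hs)

theorem abs_forwardMean_sub_le {c ε C : ℝ} (hε : 0 < ε) {g : ℝ → ℝ}
    (hg : ContinuousOn g (Icc c (c + ε))) (y : ℝ) (h : ∀ s ∈ Icc c (c + ε), |g s - y| ≤ C) :
    |forwardMean c ε g - y| ≤ C := by
  have hgi : IntervalIntegrable g volume c (c + ε) :=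
    hg.intervalIntegrable_of_Icc (by linarith)
  have hmean : forwardMean c ε g - y = forwardMean c ε fun s => g s - y := by
    rw [forwardMean, forwardMean, intervalIntegral.integral_sub hgi intervalIntegrable_const,
      intervalIntegral.integral_const, smul_eq_mul]
    field_simp
    ring
  rw [hmean]
  exact abs_forwardMean_le hε h

theorem setIntegral_initialLayer {G : ℝ × ℝ → ℝ} (hG : Integrable G) (dt : ℝ) :
    ∫ p in univ ×ˢ Ico 0 dt, G p = ∫ x, ∫ t in Ico 0 dt, G (x, t) := by
  rw [Measure.volume_eq_prod] at hG ⊢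
  rw [setIntegral_prod _ hG.integrableOn, setIntegral_univ]

theorem integrable_mul_of_bounded {g φ : ℝ × ℝ → ℝ} {M : ℝ} (hg : Measurable g)
    (hM : ∀ p, |g p| ≤ M) (hφ : Continuous φ) (hφc : HasCompactSupport φ) :
    Integrable fun p => g p * φ p :=
  (hφ.integrable_of_hasCompactSupport hφc).bdd_mul hg.aestronglyMeasurable
    (Eventually.of_forall hM)

theorem initialLayer_eq_integral_forwardMean {φ G : ℝ × ℝ → ℝ} {M dt : ℝ} (hφ : Continuous φ)
    (hφc : HasCompactSupport φ) (hdt : 0 < dt) (hG : Measurable G) (hM : ∀ p, |G p| ≤ M)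
    (hlayer : ∀ p : ℝ × ℝ, p.2 ∈ Ico 0 dt → G p = G (p.1, 0)) :
    dt⁻¹ * ∫ p in univ ×ˢ Ico 0 dt, G p * φ p =
      ∫ x, G (x, 0) * forwardMean 0 dt fun t => φ (x, t) := by
  rw [setIntegral_initialLayer (integrable_mul_of_bounded hG hM hφ hφc), ← integral_const_mul]
  congr 1
  ext x
  have hx : ∫ t in Ico 0 dt, G (x, t) * φ (x, t) = ∫ t in Ico 0 dt, G (x, 0) * φ (x, t) :=
    setIntegral_congr_fun measurableSet_Ico fun t ht => by simp only [hlayer (x, t) ht]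
  rw [hx, integral_const_mul, forwardMean, zero_add, intervalIntegral.integral_of_le hdt.le,
    integral_Ico_eq_integral_Ioc]
  ring

theorem measurable_forwardMean_slice {φ : ℝ × ℝ → ℝ} (hφ : Continuous φ) {dt : ℝ} (hdt : 0 < dt) :
    Measurable fun x => forwardMean 0 dt fun t => φ (x, t) := by
  simp_rw [forwardMean, zero_add, intervalIntegral.integral_of_le hdt.le]
  exact (hφ.stronglyMeasurable.integral_prod_right'
    (ν := volume.restrict (Ioc 0 dt))).measurable.const_mul _

theorem tendsto_forwardMean_zero {ψ : ℝ → ℝ} (hψ : Continuous ψ) (c : ℝ) {ε : ℕ → ℝ}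
    (hpos : ∀ m, 0 < ε m) (hε : Tendsto ε atTop (𝓝 0)) :
    Tendsto (fun m => forwardMean c (ε m) ψ) atTop (𝓝 (ψ c)) := by
  have hderiv : HasDerivAt (fun y => ∫ s in c..y, ψ s) (ψ c) c :=
    hψ.integral_hasStrictDerivAt c c |>.hasDerivAt
  refine (hderiv.tendsto_slope_zero.comp
    (tendsto_nhdsWithin_iff.2 ⟨hε, Eventually.of_forall fun m => (hpos m).ne'⟩)).congr fun m => ?_
  simp [forwardMean]

theorem tendsto_initialLayer {φ : ℝ × ℝ → ℝ} (hφ : Continuous φ) (hφc : HasCompactSupport φ)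
    {dt : ℕ → ℝ} (hpos : ∀ m, 0 < dt m) (hdt : Tendsto dt atTop (𝓝 0))
    {G : ℕ → ℝ × ℝ → ℝ} {g₀ : ℝ → ℝ} {M : ℝ} (hG : ∀ m, Measurable (G m))
    (hM : ∀ m p, |G m p| ≤ M)
    (hlayer : ∀ m (p : ℝ × ℝ), p.2 ∈ Ico 0 (dt m) → G m p = G m (p.1, 0))
    (hlim : ∀ᵐ x, Tendsto (fun m => G m (x, 0)) atTop (𝓝 (g₀ x))) :
    Tendsto (fun m => (dt m)⁻¹ * ∫ p in univ ×ˢ Ico 0 (dt m), G m p * φ p) atTop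
      (𝓝 (∫ x, g₀ x * φ (x, 0))) := by
  simp_rw [fun m => initialLayer_eq_integral_forwardMean hφ hφc (hpos m) (hG m) (hM m) (hlayer m)]
  set T : Set ℝ := Prod.fst '' tsupport φ
  have hT : IsCompact T := hφc.isCompact.image continuous_fst
  obtain ⟨B, hB⟩ := hφc.exists_bound_of_continuous hφ
  refine tendsto_integral_of_dominated_convergence (fun x => M * T.indicator (fun _ => B) x)
    (fun m => ?_) ?_ (fun m => Eventually.of_forall fun x => ?_) ?_
  · exact (((hG m).comp measurable_prodMk_right).mul
      (measurable_forwardMean_slice hφ (hpos m))).aestronglyMeasurable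
  · exact ((integrable_indicator_iff hT.measurableSet).2
      (integrableOn_const hT.measure_lt_top.ne)).const_mul M
  · rw [Real.norm_eq_abs, abs_mul]
    refine mul_le_mul (hM m _) (abs_forwardMean_le (hpos m) fun t _ => ?_) (abs_nonneg _)
      ((abs_nonneg _).trans (hM m (x, 0)))
    by_cases hx : x ∈ T
    · rw [indicator_of_mem hx]
      exact hB (x, t)
    · rw [indicator_of_notMem hx, image_eq_zero_of_notMem_tsupport fun h => hx ⟨_, h, rfl⟩,
        abs_zero]
  · filter_upwards [hlim] with x hx
    exact hx.mul (tendsto_forwardMean_zero (hφ.comp (by fun_prop)) 0 hpos hdt)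

theorem setIntegral_halfPlane_translate_mul (g φ : ℝ × ℝ → ℝ) (h dt : ℝ) :
    ∫ p in halfPlane, g (p + (h, 0)) * φ (p + (0, dt)) =
      ∫ p in halfPlane, g p * φ (p + (-h, dt)) := by
  rw [← setIntegral_halfPlane_comp_add (fun p => g p * φ (p + (-h, dt))) h 0]
  simp only [add_assoc, Prod.mk_add_mk, add_neg_cancel, zero_add]

theorem setIntegral_halfPlane_eq_layer_add {G : ℝ × ℝ → ℝ} (hG : Integrable G) {dt : ℝ}
    (hdt : 0 ≤ dt) :
    ∫ p in halfPlane, G p =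
      (∫ p in univ ×ˢ Ico 0 dt, G p) + ∫ p in halfPlane, G (p + (0, dt)) := by
  have hset : halfPlane = univ ×ˢ Ico 0 dt ∪ {p : ℝ × ℝ | dt ≤ p.2} := by
    ext p
    simp only [mem_ofPred_eq, mem_union, mem_prod, mem_univ, true_and, mem_Ico]
    exact ⟨fun h => (lt_or_ge p.2 dt).imp (⟨h, ·⟩) id, fun h => h.elim And.left hdt.trans⟩
  have hdisj : Disjoint (univ ×ˢ Ico 0 dt) {p : ℝ × ℝ | dt ≤ p.2} :=
    disjoint_left.2 fun p hp hp' => hp'.not_gt hp.2.2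
  rw [setIntegral_halfPlane_comp_add, hset, setIntegral_union hdisj (measurableSet_le_snd dt)
    hG.integrableOn hG.integrableOn]

theorem integral_half_add_sub_mul_sub_add {X : Type*} [MeasurableSpace X] {μ : Measure X}
    {A B C D E : X → ℝ} {lam : ℝ} (hA : Integrable A μ) (hB : Integrable B μ)
    (hC : Integrable C μ) (hD : Integrable D μ) (hE : Integrable E μ) :
    ∫ x, (1 / 2 * (A x + B x) - lam * (C x - D x) + E x) ∂μ =
      1 / 2 * ((∫ x, A x ∂μ) + ∫ x, B x ∂μ) - lam * ((∫ x, C x ∂μ) - ∫ x, D x ∂μ) +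
        ∫ x, E x ∂μ := by
  have hAB : Integrable (fun x => 1 / 2 * (A x + B x)) μ := (hA.add hB).const_mul _
  have hCD : Integrable (fun x => lam * (C x - D x)) μ := (hC.sub hD).const_mul _
  have hABCD : Integrable (fun x => 1 / 2 * (A x + B x) - lam * (C x - D x)) μ := hAB.sub hCD
  rw [integral_add hABCD hE, integral_sub hAB hCD, integral_const_mul, integral_const_mul,
    integral_add hA hB, integral_sub hC hD]

theorem weak_inequality_of_step {η q e φ : ℝ × ℝ → ℝ} {lam h dt M : ℝ} (hdt : 0 < dt)
    (hφ : Continuous φ) (hφc : HasCompactSupport φ) (hφ0 : ∀ p ∈ halfPlane, 0 ≤ φ p)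
    (hη : Measurable η) (hq : Measurable q) (hηM : ∀ p, |η p| ≤ M) (hqM : ∀ p, |q p| ≤ M)
    (hstep : ∀ p ∈ halfPlane, η (p + (0, dt)) ≤
      1 / 2 * (η (p + (h, 0)) + η (p + (-h, 0))) - lam * (q (p + (h, 0)) - q (p + (-h, 0))) + e p)
    (he : IntegrableOn (fun p => e p * φ (p + (0, dt))) halfPlane) :
    0 ≤ 1 / 2 * ((∫ p in halfPlane, η p * (φ (p + (h, dt)) - φ p)) +
          ∫ p in halfPlane, η p * (φ (p + (-h, dt)) - φ p)) +
        lam * ((∫ p in halfPlane, q p * (φ (p + (h, dt)) - φ p)) -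
          ∫ p in halfPlane, q p * (φ (p + (-h, dt)) - φ p)) +
        (∫ p in univ ×ˢ Ico 0 dt, η p * φ p) + ∫ p in halfPlane, e p * φ (p + (0, dt)) := by
  have hφw (w : ℝ × ℝ) : HasCompactSupport fun p => φ (p + w) :=
    hφc.comp_homeomorph (Homeomorph.addRight w)
  have hint {g : ℝ × ℝ → ℝ} (hg : Measurable g) (hgM : ∀ p, |g p| ≤ M) (w : ℝ × ℝ) :
      Integrable fun p => g p * φ (p + w) :=
    integrable_mul_of_bounded hg hgM (hφ.comp (continuous_add_const w)) (hφw w)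
  have hint_shift {g : ℝ × ℝ → ℝ} (hg : Measurable g) (hgM : ∀ p, |g p| ≤ M) (w : ℝ × ℝ) :
      IntegrableOn (fun p => g (p + w) * φ (p + (0, dt))) halfPlane :=
    (integrable_mul_of_bounded (hg.comp (measurable_add_const w)) (fun p => hgM _)
      (hφ.comp (continuous_add_const _)) (hφw _)).integrableOn
  have hdiff {g : ℝ × ℝ → ℝ} (hg : Measurable g) (hgM : ∀ p, |g p| ≤ M) (s : ℝ) :
      ∫ p in halfPlane, g p * (φ (p + (s, dt)) - φ p) =
        (∫ p in halfPlane, g (p + (-s, 0)) * φ (p + (0, dt))) - ∫ p in halfPlane, g p * φ p := by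
    rw [setIntegral_halfPlane_translate_mul, neg_neg, ← integral_sub (hint hg hgM _).integrableOn
      (integrable_mul_of_bounded hg hgM hφ hφc).integrableOn]
    simp only [mul_sub]
  have hη₁ := hint_shift hη hηM (h, 0)
  have hη₂ := hint_shift hη hηM (-h, 0)
  have hq₁ := hint_shift hq hqM (h, 0)
  have hq₂ := hint_shift hq hqM (-h, 0)
  have hmono := (setIntegral_mono_on (hint_shift hη hηM (0, dt))
    ((((hη₁.add hη₂).const_mul (1 / 2)).sub ((hq₁.sub hq₂).const_mul lam)).add he)
    (measurableSet_le_snd 0) fun p hp => ?_).trans_eq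
    (integral_half_add_sub_mul_sub_add hη₁ hη₂ hq₁ hq₂ he)
  · have hlayer := setIntegral_halfPlane_eq_layer_add
      (integrable_mul_of_bounded hη hηM hφ hφc) hdt.le
    rw [hdiff hη hηM, hdiff hη hηM, hdiff hq hqM, hdiff hq hqM, neg_neg]
    linarith
  · have hφp : 0 ≤ φ (p + (0, dt)) := hφ0 _ (by simpa using add_nonneg hp hdt.le)
    simp only [Pi.add_apply, Pi.sub_apply]
    linarith [mul_le_mul_of_nonneg_right (hstep p hp) hφp]

theorem integral_mul_fderiv_eq_apply {E : Type*} [NormedAddCommGroup E] [NormedSpace ℝ E]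
    [ProperSpace E] [MeasurableSpace E] [BorelSpace E] {μ : Measure E}
    [IsFiniteMeasureOnCompacts μ] {φ : E → ℝ} {g : ℕ → E → ℝ} {g₀ : E → ℝ} {M : ℝ}
    (hφ : ContDiff ℝ 1 φ) (hφc : HasCompactSupport φ) (hg : ∀ m, AEStronglyMeasurable (g m) μ)
    (hM : ∀ m p, |g m p| ≤ M)
    (hlim : ∀ᵐ p ∂μ, Tendsto (fun m => g m p) atTop (𝓝 (g₀ p))) (v : E) :
    ∫ p, g₀ p * fderiv ℝ φ p v ∂μ = (∫ p, g₀ p • fderiv ℝ φ p ∂μ) v := by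
  have hbound : ∀ᵐ p ∂μ, ‖g₀ p‖ ≤ M := hlim.mono fun p hp =>
    le_of_tendsto hp.norm (Eventually.of_forall fun m => hM m p)
  have hint : Integrable (fun p => g₀ p • fderiv ℝ φ p) μ :=
    ((hφ.continuous_fderiv one_ne_zero).integrable_of_hasCompactSupport
      (hφc.fderiv ℝ)).bdd_smul M (aestronglyMeasurable_of_tendsto_ae _ hg hlim) hbound
  rw [ContinuousLinearMap.integral_apply hint]
  rfl

/-- Both the viscous average and the flux difference of the step contribute difference quotients
of `φ` in the directions `(±1/2, lam)`; their sum and difference give `φ_t` and `φ_x`. -/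
theorem lax_wendroff {lam M : ℝ} (hlam : 0 < lam) {dx δ : ℕ → ℝ} (hpos : ∀ m, 0 < dx m)
    (hdx : Tendsto dx atTop (𝓝 0)) {φ : ℝ × ℝ → ℝ} (hφ : ContDiff ℝ 1 φ)
    (hφc : HasCompactSupport φ) (hφ0 : ∀ p ∈ halfPlane, 0 ≤ φ p)
    {η q e : ℕ → ℝ × ℝ → ℝ} {η₀ q₀ : ℝ × ℝ → ℝ} {g₀ : ℝ → ℝ}
    (hη : ∀ m, Measurable (η m)) (hq : ∀ m, Measurable (q m))
    (hηM : ∀ m p, |η m p| ≤ M) (hqM : ∀ m p, |q m p| ≤ M)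
    (hηlim : ∀ᵐ p ∂volume.restrict halfPlane, Tendsto (fun m => η m p) atTop (𝓝 (η₀ p)))
    (hqlim : ∀ᵐ p ∂volume.restrict halfPlane, Tendsto (fun m => q m p) atTop (𝓝 (q₀ p)))
    (hlayer : ∀ m (p : ℝ × ℝ), p.2 ∈ Ico 0 (lam * dx m) → η m p = η m (p.1, 0))
    (hinit : ∀ᵐ x, Tendsto (fun m => η m (x, 0)) atTop (𝓝 (g₀ x)))
    (hstep : ∀ m, ∀ p ∈ halfPlane, η m (p + (0, lam * dx m)) ≤
      1 / 2 * (η m (p + (dx m / 2, 0)) + η m (p + (-(dx m / 2), 0))) -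
        lam * (q m (p + (dx m / 2, 0)) - q m (p + (-(dx m / 2), 0))) + e m p)
    (he : ∀ m, IntegrableOn (fun p => e m p * φ (p + (0, lam * dx m))) halfPlane)
    (hδ : Tendsto δ atTop (𝓝 0))
    (heδ : ∀ m, (dx m)⁻¹ * ∫ p in halfPlane, e m p * φ (p + (0, lam * dx m)) ≤ δ m) :
    0 ≤ (∫ p in halfPlane, η₀ p * fderiv ℝ φ p (0, 1)) + (∫ x, g₀ x * φ (x, 0)) +
      ∫ p in halfPlane, q₀ p * fderiv ℝ φ p (1, 0) := by
  have hdt_pos (m : ℕ) : 0 < lam * dx m := mul_pos hlam (hpos m)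
  have hdt : Tendsto (fun m => lam * dx m) atTop (𝓝 0) := by simpa using hdx.const_mul lam
  have hdir (m : ℕ) (s : ℝ) : ((s * dx m, lam * dx m) : ℝ × ℝ) = dx m • (s, lam) := by
    simp [mul_comm]
  have hhalf (m : ℕ) : dx m / 2 = 1 / 2 * dx m := by ring
  have hη_tendsto := tendsto_integral_mul_differenceQuotient hφ hφc hpos hdx
    (fun m => (hη m).aestronglyMeasurable) hηM hηlim
  have hq_tendsto := tendsto_integral_mul_differenceQuotient hφ hφc hpos hdx
    (fun m => (hq m).aestronglyMeasurable) hqM hqlim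
  have hinit_tendsto := tendsto_initialLayer hφ.continuous hφc hdt_pos hdt hη hηM hlayer hinit
  have hlimit := ((((hη_tendsto (1 / 2, lam)).add (hη_tendsto (-(1 / 2), lam))).const_mul
    (1 / 2)).add (((hq_tendsto (1 / 2, lam)).sub (hq_tendsto (-(1 / 2), lam))).const_mul lam)).add
    (hinit_tendsto.const_mul lam) |>.add hδ
  have hnonneg := ge_of_tendsto' (b := 0) hlimit fun m => ?_
  · simp only [integral_mul_fderiv_eq_apply hφ hφc (fun m => (hη m).aestronglyMeasurable) hηM hηlim,
      integral_mul_fderiv_eq_apply hφ hφc (fun m => (hq m).aestronglyMeasurable) hqM hqlim,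
      ← map_add, ← map_sub] at hnonneg ⊢
    have ht : ((1 / 2, lam) + (-(1 / 2), lam) : ℝ × ℝ) = (2 * lam) • (0, 1) := by
      ext <;> simp; ring
    have hx : ((1 / 2, lam) - (-(1 / 2), lam) : ℝ × ℝ) = (1, 0) := by
      ext <;> norm_num
    rw [ht, hx, map_smul, smul_eq_mul] at hnonneg
    refine nonneg_of_mul_nonneg_right (a := lam) ?_ hlam
    linarith
  · have hweak := weak_inequality_of_step (hdt_pos m) hφ.continuous hφc hφ0 (hη m) (hq m) (hηM m)
      (hqM m) (hstep m) (he m)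
    simp only [hhalf, ← neg_mul, hdir] at hweak
    have hdiv := mul_nonneg (inv_pos.2 (hpos m)).le hweak
    have hinv : lam * (lam * dx m)⁻¹ = (dx m)⁻¹ := by field_simp
    rw [← mul_assoc lam (lam * dx m)⁻¹, hinv]
    linarith [heδ m]

section KruzhkovFlux

/-- The Kruzhkov entropy flux of the flux function `g`, for the entropy `|· - c|`. -/
noncomputable def kruzhkovFlux (g : ℝ → ℝ) (c v : ℝ) : ℝ := Real.sign (v - c) * (g v - g c)

variable {g : ℝ → ℝ} {c v : ℝ}

theorem kruzhkovFlux_of_le (h : c ≤ v) : kruzhkovFlux g c v = g v - g c := by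
  rcases h.eq_or_lt with rfl | h
  · simp [kruzhkovFlux]
  · rw [kruzhkovFlux, Real.sign_of_pos (sub_pos.2 h), one_mul]

theorem kruzhkovFlux_comm (g : ℝ → ℝ) (c v : ℝ) : kruzhkovFlux g c v = kruzhkovFlux g v c := by
  rw [kruzhkovFlux, kruzhkovFlux, ← neg_sub c v, Real.sign_neg]
  ring

theorem kruzhkovFlux_of_ge (h : v ≤ c) : kruzhkovFlux g c v = g c - g v := by
  rw [kruzhkovFlux_comm, kruzhkovFlux_of_le h]

theorem kruzhkovFlux_id (c v : ℝ) : kruzhkovFlux id c v = |v - c| := by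
  rcases le_total c v with h | h
  · rw [kruzhkovFlux_of_le h, abs_of_nonneg (sub_nonneg.2 h), id, id]
  · rw [kruzhkovFlux_of_ge h, abs_of_nonpos (sub_nonpos.2 h), neg_sub, id, id]

theorem abs_kruzhkovFlux_sub_le {S : Set ℝ} [S.OrdConnected] {l : ℝ}
    (hg : ∀ v ∈ S, ∀ w ∈ S, |g v - g w| ≤ l * |v - w|) {w : ℝ} (hv : v ∈ S) (hw : w ∈ S) (c : ℝ) :
    |kruzhkovFlux g c v - kruzhkovFlux g c w| ≤ l * |v - w| := by
  wlog hvw : v ≤ w generalizing v w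
  · rw [abs_sub_comm, abs_sub_comm v]
    exact this hw hv (le_of_not_ge hvw)
  rcases le_total c v with hcv | hvc
  · rw [kruzhkovFlux_of_le hcv, kruzhkovFlux_of_le (hcv.trans hvw), sub_sub_sub_cancel_right]
    exact hg v hv w hw
  rcases le_total w c with hwc | hcw
  · rw [kruzhkovFlux_of_ge hvc, kruzhkovFlux_of_ge hwc, sub_sub_sub_cancel_left, abs_sub_comm v]
    exact hg w hw v hv
  have hc : c ∈ S := Set.OrdConnected.out ‹_› hv hw ⟨hvc, hcw⟩
  rw [kruzhkovFlux_of_ge hvc, kruzhkovFlux_of_le hcw]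
  calc |g c - g v - (g w - g c)| ≤ |g c - g v| + |g w - g c| := abs_sub _ _
    _ ≤ l * |c - v| + l * |w - c| := add_le_add (hg c hc v hv) (hg w hw c hc)
    _ = l * |v - w| := by
      rw [abs_of_nonneg (sub_nonneg.2 hvc), abs_of_nonneg (sub_nonneg.2 hcw),
        abs_of_nonpos (sub_nonpos.2 hvw)]
      ring

theorem abs_half_mul_sub_add_eq {μ : ℝ} (h : |μ * (g v - g c)| ≤ 1 / 2 * |v - c|) :
    |1 / 2 * (v - c) + μ * (g v - g c)| = 1 / 2 * |v - c| + μ * kruzhkovFlux g c v := by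
  rcases le_total c v with hcv | hvc
  · rw [abs_of_nonneg (sub_nonneg.2 hcv)] at h ⊢
    rw [kruzhkovFlux_of_le hcv, abs_of_nonneg (by linarith [neg_le_of_abs_le h])]
  · rw [abs_of_nonpos (sub_nonpos.2 hvc)] at h ⊢
    rw [kruzhkovFlux_of_ge hvc, abs_of_nonpos (by linarith [le_of_abs_le h])]
    ring

theorem abs_laxFriedrichs_sub_le {g₁ g₂ : ℝ → ℝ} {lam u₁ u₂ s : ℝ} (hlam : 0 ≤ lam)
    (h₁ : lam * |g₁ u₁ - g₁ s| ≤ 1 / 2 * |u₁ - s|) (h₂ : lam * |g₂ u₂ - g₂ s| ≤ 1 / 2 * |u₂ - s|) :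
    |1 / 2 * (u₁ + u₂) - lam * (g₂ u₂ - g₁ u₁) - s| ≤
      1 / 2 * (|u₁ - s| + |u₂ - s|) - lam * (kruzhkovFlux g₂ s u₂ - kruzhkovFlux g₁ s u₁) +
        lam * |g₂ s - g₁ s| := by
  have e₁ : |1 / 2 * (u₁ - s) + lam * (g₁ u₁ - g₁ s)| = _ :=
    abs_half_mul_sub_add_eq (by rwa [abs_mul, abs_of_nonneg hlam])
  have e₂ : |1 / 2 * (u₂ - s) + -lam * (g₂ u₂ - g₂ s)| = _ :=
    abs_half_mul_sub_add_eq (by rwa [abs_mul, abs_neg, abs_of_nonneg hlam])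
  calc |1 / 2 * (u₁ + u₂) - lam * (g₂ u₂ - g₁ u₁) - s|
      = |(1 / 2 * (u₁ - s) + lam * (g₁ u₁ - g₁ s)) + (1 / 2 * (u₂ - s) + -lam * (g₂ u₂ - g₂ s)) +
          lam * (g₁ s - g₂ s)| := by congr 1; ring
    _ ≤ _ := abs_add_three _ _ _
    _ = _ := by
      rw [e₁, e₂, abs_mul, abs_of_nonneg hlam, abs_sub_comm (g₁ s)]
      ring

end KruzhkovFlux

section AffineFlux

/-- A flux `f κ v` which for coefficients `κ` in `I` is affine in `κ` with slope `B v`, and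
which is, together with `B`, Lipschitz in the states `v` in `S`. -/
structure IsAffineFlux (f : ℝ → ℝ → ℝ) (B : ℝ → ℝ) (I S : Set ℝ) (l L : ℝ) : Prop where
  sub_eq : ∀ κ₁ ∈ I, ∀ κ₂ ∈ I, ∀ v, f κ₂ v - f κ₁ v = (κ₂ - κ₁) * B v
  abs_sub_le : ∀ κ ∈ I, ∀ v ∈ S, ∀ w ∈ S, |f κ v - f κ w| ≤ l * |v - w|
  abs_slope_sub_le : ∀ v ∈ S, ∀ w ∈ S, |B v - B w| ≤ L * |v - w|

theorem sub_eq_mul_slope_of_iteratedDerivWithin_two_eq_zero {g : ℝ → ℝ} {a b : ℝ}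
    (hg : ContDiffOn ℝ 2 g (Icc a b))
    (hg₂ : ∀ x ∈ Icc a b, iteratedDerivWithin 2 g (Icc a b) x = 0) {x y : ℝ} (hx : x ∈ Icc a b)
    (hy : y ∈ Icc a b) : g y - g x = (y - x) * ((g b - g a) / (b - a)) := by
  rcases (hx.1.trans hx.2).eq_or_lt with rfl | hab
  · simp [le_antisymm hx.2 hx.1, le_antisymm hy.2 hy.1]
  have hu : UniqueDiffOn ℝ (Icc a b) := uniqueDiffOn_Icc hab
  set d := derivWithin g (Icc a b)
  have hd_const : ∀ x ∈ Icc a b, d x = d a := by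
    refine constant_of_derivWithin_zero
      ((hg.derivWithin hu (m := 1) (by norm_num)).differentiableOn (by norm_num)) fun x hx => ?_
    rw [← hg₂ x (Ico_subset_Icc_self hx), iteratedDerivWithin_succ]
    exact congrArg (derivWithin · (Icc a b) x) (funext fun y => by rw [iteratedDerivWithin_one])
  have hg_affine : ∀ x ∈ Icc a b, g x - x * d a = g a - a * d a := by
    have hgd : DifferentiableOn ℝ g (Icc a b) := hg.differentiableOn (by norm_num)
    refine constant_of_derivWithin_zero (f := fun x => g x - x * d a)
      (hgd.sub (differentiableOn_id.mul_const _)) fun x hx => ?_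
    have hx' := Ico_subset_Icc_self hx
    have h : HasDerivWithinAt (fun x => g x - x * d a) (d x - 1 * d a) (Icc a b) x :=
      (hgd x hx').hasDerivWithinAt.sub ((hasDerivWithinAt_id x _).mul_const (d a))
    rw [h.derivWithin (hu x hx'), one_mul, hd_const x hx', sub_self]
  have hslope : d a = (g b - g a) / (b - a) := by
    rw [eq_div_iff (sub_pos.2 hab).ne']
    linarith [hg_affine b ⟨hab.le, le_rfl⟩]
  rw [← hslope]
  linarith [hg_affine x hx, hg_affine y hy]

theorem abs_sub_le_of_abs_derivWithin_le {g : ℝ → ℝ} {S : Set ℝ} (hS : Convex ℝ S) {C : ℝ}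
    (hg : DifferentiableOn ℝ g S) (hC : ∀ v ∈ S, |derivWithin g S v| ≤ C) {v w : ℝ} (hv : v ∈ S)
    (hw : w ∈ S) : |g v - g w| ≤ C * |v - w| :=
  hS.norm_image_sub_le_of_norm_derivWithin_le hg hC hw hv

theorem exists_isAffineFlux {f : ℝ → ℝ → ℝ} {kl ku l : ℝ} {S : Set ℝ} (hkk : kl ≤ ku)
    (hf_k : ∀ v, ContDiffOn ℝ 2 (fun κ => f κ v) (Icc kl ku))
    (hf_kk : ∀ v, ∀ κ ∈ Icc kl ku, iteratedDerivWithin 2 (fun κ' => f κ' v) (Icc kl ku) κ = 0)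
    (hf_u : ∀ κ ∈ Icc kl ku, ∀ v ∈ S, ∀ w ∈ S, |f κ v - f κ w| ≤ l * |v - w|) :
    ∃ B L, IsAffineFlux f B (Icc kl ku) S l L := by
  refine ⟨fun v => (f ku v - f kl v) / (ku - kl), 2 * l / (ku - kl), ⟨fun κ₁ h₁ κ₂ h₂ v => ?_,
    hf_u, fun v hv w hw => ?_⟩⟩
  · exact sub_eq_mul_slope_of_iteratedDerivWithin_two_eq_zero (hf_k v) (hf_kk v) h₁ h₂
  · rw [← sub_div, abs_div, abs_of_nonneg (sub_nonneg.2 hkk), div_mul_eq_mul_div]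
    refine div_le_div_of_nonneg_right ?_ (sub_nonneg.2 hkk)
    calc |f ku v - f kl v - (f ku w - f kl w)|
        = |(f ku v - f ku w) - (f kl v - f kl w)| := by congr 1; ring
      _ ≤ |f ku v - f ku w| + |f kl v - f kl w| := abs_sub _ _
      _ ≤ l * |v - w| + l * |v - w| := add_le_add (hf_u ku (right_mem_Icc.2 hkk) v hv w hw)
        (hf_u kl (left_mem_Icc.2 hkk) v hv w hw)
      _ = 2 * l * |v - w| := by ring

theorem IsAffineFlux.abs_flux_sub_eq {f : ℝ → ℝ → ℝ} {B : ℝ → ℝ} {I S : Set ℝ} {l L : ℝ}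
    (hf : IsAffineFlux f B I S l L) {κ₁ κ₂ : ℝ} (h₁ : κ₁ ∈ I) (h₂ : κ₂ ∈ I) (v : ℝ) :
    |f κ₂ v - f κ₁ v| = |B v| * |κ₂ - κ₁| := by
  rw [hf.sub_eq κ₁ h₁ κ₂ h₂, abs_mul, mul_comm]

end AffineFlux

section DiscreteEntropy

/-- An entropy for the corrected Lax–Friedrichs scheme with mesh ratio `lam`, coefficients in `I`
and states in `S`. If `w` is the predictor value plus a correction, the entropy at `w` exceeds the
balance of the predictor step by at most `subgradient w` times the correction. The variation of
the coefficient enters through `source`. The subgradient is Lipschitz with constant `L`. -/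
structure DiscreteEntropy (f : ℝ → ℝ → ℝ) (I S : Set ℝ) (lam L : ℝ) where
  entropy : ℝ → ℝ
  flux : ℝ → ℝ → ℝ
  subgradient : ℝ → ℝ
  source : ℝ
  source_nonneg : 0 ≤ source
  abs_subgradient_le : ∀ v, |subgradient v| ≤ 1
  abs_subgradient_sub_le : ∀ v w, |subgradient v - subgradient w| ≤ L * |v - w|
  step_le : ∀ κ₁ ∈ I, ∀ κ₂ ∈ I, ∀ u₁ ∈ S, ∀ u₂ ∈ S, ∀ w,
    entropy w ≤ 1 / 2 * (entropy u₁ + entropy u₂) - lam * (flux κ₂ u₂ - flux κ₁ u₁) +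
      lam * (source * |κ₂ - κ₁|) +
      subgradient w * (w - (1 / 2 * (u₁ + u₂) - lam * (f κ₂ u₂ - f κ₁ u₁)))

/-- The entropy `E` is within `δ` of the Kruzhkov entropy `|· - c|`, in its values, its fluxes and
its source, for a flux with slope `B`. -/
structure DiscreteEntropy.Approximates {f : ℝ → ℝ → ℝ} {I S : Set ℝ} {lam L : ℝ}
    (E : DiscreteEntropy f I S lam L) (B : ℝ → ℝ) (c δ : ℝ) : Prop where
  abs_entropy_sub_le : ∀ v ∈ S, |E.entropy v - (|v - c|)| ≤ δ
  abs_flux_sub_le : ∀ κ ∈ I, ∀ v ∈ S, |E.flux κ v - kruzhkovFlux (f κ) c v| ≤ δ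
  abs_source_sub_le : |E.source - (|B c|)| ≤ δ

variable {f : ℝ → ℝ → ℝ} {B : ℝ → ℝ} {I S : Set ℝ} {l L lam c : ℝ}

/-- The entropy `σ * (v - c)` with `|σ| = 1`, which is the Kruzhkov entropy for states on one side
of `c`. -/
noncomputable def linearEntropy (hf : IsAffineFlux f B I S l L) (hlam : 0 ≤ lam) (c : ℝ) {σ : ℝ}
    (hσ : |σ| = 1) {L' : ℝ} (hL' : 0 ≤ L') : DiscreteEntropy f I S lam L' where
  entropy v := σ * (v - c)
  flux κ v := σ * (f κ v - f κ c)
  subgradient _ := σ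
  source := |B c|
  source_nonneg := abs_nonneg _
  abs_subgradient_le _ := hσ.le
  abs_subgradient_sub_le v w := by
    rw [sub_self, abs_zero]
    positivity
  step_le κ₁ hκ₁ κ₂ hκ₂ u₁ _ u₂ _ w := by
    have h : -(σ * (f κ₂ c - f κ₁ c)) ≤ |B c| * |κ₂ - κ₁| := by
      rw [← hf.abs_flux_sub_eq hκ₁ hκ₂]
      simpa only [abs_mul, hσ, one_mul] using neg_le_abs (σ * (f κ₂ c - f κ₁ c))
    linarith [mul_le_mul_of_nonneg_left h hlam]

theorem linearEntropy_approximates (hf : IsAffineFlux f B I S l L) (hlam : 0 ≤ lam) {σ : ℝ}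
    (hσ : |σ| = 1) {L' : ℝ} (hL' : 0 ≤ L') (hS : ∀ v ∈ S, Real.sign (v - c) = σ ∨ v = c) {δ : ℝ}
    (hδ : 0 ≤ δ) : (linearEntropy hf hlam c hσ hL').Approximates B c δ := by
  have hflux : ∀ (g : ℝ → ℝ), ∀ v ∈ S, σ * (g v - g c) = kruzhkovFlux g c v := by
    intro g v hv
    rcases hS v hv with rfl | rfl
    · rfl
    · simp [kruzhkovFlux]
  refine ⟨fun v hv => ?_, fun κ _ v hv => ?_, ?_⟩
  · rw [← kruzhkovFlux_id c v, ← hflux id v hv]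
    simpa only [linearEntropy, id, sub_self, abs_zero] using hδ
  · rw [← hflux (f κ) v hv]
    simpa only [linearEntropy, sub_self, abs_zero] using hδ
  · simpa only [linearEntropy, sub_self, abs_zero] using hδ

theorem abs_sub_le_add_subgradient_mul (w z s : ℝ) :
    |w - s| ≤ |z - s| + (if s ≤ w then (1 : ℝ) else -1) * (w - z) := by
  split_ifs with h
  · rw [abs_of_nonneg (sub_nonneg.2 h)]
    linarith [le_abs_self (z - s)]
  · rw [abs_of_neg (sub_neg.2 (not_le.1 h))]
    linarith [neg_abs_le (z - s)]

theorem intervalIntegrable_subgradient (w a b : ℝ) :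
    IntervalIntegrable (fun s => if s ≤ w then (1 : ℝ) else -1) volume a b := by
  refine AntitoneOn.intervalIntegrable fun x _ y _ hxy => ?_
  split_ifs <;> linarith

theorem forwardMean_subgradient (w c ε : ℝ) :
    forwardMean c ε (fun s => if s ≤ w then (1 : ℝ) else -1) =
      (|w - c| - |w - (c + ε)|) / ε := by
  have hderiv : ∀ x, x ≠ w → HasDerivAt (fun s => -|w - s|) (if x ≤ w then (1 : ℝ) else -1) x := by
    intro x hx
    have hsub : HasDerivAt (fun s => w - s) (-1) x := (hasDerivAt_id x).const_sub w
    rcases hx.lt_or_gt with h | h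
    · convert! ((hasDerivAt_abs_pos (sub_pos.2 h)).comp x hsub).neg using 1
      simp [h.le]
    · convert! ((hasDerivAt_abs_neg (sub_neg.2 h)).comp x hsub).neg using 1
      simp [h.not_ge]
  rw [forwardMean, integral_eq_of_hasDerivAt_off_countable (fun s => -|w - s|) _
    (countable_singleton w) (by fun_prop) (fun x hx => hderiv x hx.2)
    (intervalIntegrable_subgradient w _ _)]
  ring

theorem kruzhkov_step_le {ul uu : ℝ} (hf : IsAffineFlux f B I (Icc ul uu) l L) (hlam : 0 ≤ lam)
    (hCFL : lam * l ≤ 1 / 2) {κ₁ κ₂ u₁ u₂ s : ℝ} (hκ₁ : κ₁ ∈ I) (hκ₂ : κ₂ ∈ I)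
    (hu₁ : u₁ ∈ Icc ul uu) (hu₂ : u₂ ∈ Icc ul uu) (hs : s ∈ Icc ul uu) (w : ℝ) :
    |w - s| ≤ 1 / 2 * (|u₁ - s| + |u₂ - s|) -
        lam * (kruzhkovFlux (f κ₂) s u₂ - kruzhkovFlux (f κ₁) s u₁) +
        lam * (|B s| * |κ₂ - κ₁|) + (if s ≤ w then (1 : ℝ) else -1) *
          (w - (1 / 2 * (u₁ + u₂) - lam * (f κ₂ u₂ - f κ₁ u₁))) := by
  have hlip : ∀ κ ∈ I, ∀ v ∈ Icc ul uu, lam * |f κ v - f κ s| ≤ 1 / 2 * |v - s| := by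
    intro κ hκ v hv
    calc lam * |f κ v - f κ s| ≤ lam * (l * |v - s|) := by
          gcongr
          exact hf.abs_sub_le κ hκ v hv s hs
      _ = lam * l * |v - s| := by ring
      _ ≤ 1 / 2 * |v - s| := by gcongr
  have hpredictor := abs_laxFriedrichs_sub_le hlam (hlip κ₁ hκ₁ u₁ hu₁) (hlip κ₂ hκ₂ u₂ hu₂)
  rw [hf.abs_flux_sub_eq hκ₁ hκ₂] at hpredictor
  exact (abs_sub_le_add_subgradient_mul w _ s).trans (by gcongr)

theorem continuousOn_of_abs_sub_le {g : ℝ → ℝ} {S : Set ℝ} {l : ℝ}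
    (h : ∀ s ∈ S, ∀ r ∈ S, |g s - g r| ≤ l * |s - r|) : ContinuousOn g S :=
  LipschitzOnWith.continuousOn (K := l.toNNReal) <| LipschitzOnWith.of_dist_le_mul
    fun s hs r hr => (h s hs r hr).trans <|
      mul_le_mul_of_nonneg_right (Real.le_coe_toNNReal l) (abs_nonneg _)

theorem IsAffineFlux.abs_kruzhkovFlux_param_sub_le {ul uu : ℝ}
    (hf : IsAffineFlux f B I (Icc ul uu) l L) {κ : ℝ} (hκ : κ ∈ I) (v : ℝ) :
    ∀ s ∈ Icc ul uu, ∀ r ∈ Icc ul uu,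
      |kruzhkovFlux (f κ) s v - kruzhkovFlux (f κ) r v| ≤ l * |s - r| := by
  intro s hs r hr
  rw [kruzhkovFlux_comm, kruzhkovFlux_comm _ r]
  exact abs_kruzhkovFlux_sub_le (hf.abs_sub_le κ hκ) hs hr v

theorem forwardMean_kruzhkov_step_le {ul uu ε : ℝ} (hf : IsAffineFlux f B I (Icc ul uu) l L)
    (hlam : 0 ≤ lam) (hCFL : lam * l ≤ 1 / 2) (hε : 0 < ε) (hsub : Icc c (c + ε) ⊆ Icc ul uu)
    {κ₁ κ₂ u₁ u₂ : ℝ} (hκ₁ : κ₁ ∈ I) (hκ₂ : κ₂ ∈ I) (hu₁ : u₁ ∈ Icc ul uu)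
    (hu₂ : u₂ ∈ Icc ul uu) (w : ℝ) :
    forwardMean c ε (fun s => |w - s|) ≤
      1 / 2 * (forwardMean c ε (fun s => |u₁ - s|) + forwardMean c ε fun s => |u₂ - s|) -
        lam * ((forwardMean c ε fun s => kruzhkovFlux (f κ₂) s u₂) -
          forwardMean c ε fun s => kruzhkovFlux (f κ₁) s u₁) +
        lam * ((forwardMean c ε fun s => |B s|) * |κ₂ - κ₁|) + (|w - c| - |w - (c + ε)|) / ε *
          (w - (1 / 2 * (u₁ + u₂) - lam * (f κ₂ u₂ - f κ₁ u₁))) := by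
  have hle : c ≤ c + ε := by linarith
  have habs : ∀ v, IntervalIntegrable (fun s => |v - s|) volume c (c + ε) := fun v =>
    Continuous.intervalIntegrable (by fun_prop) _ _
  have hK : ∀ κ ∈ I, ∀ v, IntervalIntegrable (fun s => kruzhkovFlux (f κ) s v) volume c (c + ε) :=
    fun κ hκ v => ((continuousOn_of_abs_sub_le (hf.abs_kruzhkovFlux_param_sub_le hκ v)).mono
      hsub).intervalIntegrable_of_Icc hle
  have hB : IntervalIntegrable (fun s => |B s|) volume c (c + ε) :=
    ((continuousOn_of_abs_sub_le hf.abs_slope_sub_le).mono hsub).abs.intervalIntegrable_of_Icc hle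
  set z := w - (1 / 2 * (u₁ + u₂) - lam * (f κ₂ u₂ - f κ₁ u₁))
  have i₁ := ((habs u₁).add (habs u₂)).const_mul (1 / 2)
  have i₂ := ((hK κ₂ hκ₂ u₂).sub (hK κ₁ hκ₁ u₁)).const_mul lam
  have i₃ := (hB.mul_const |κ₂ - κ₁|).const_mul lam
  have i₄ := (intervalIntegrable_subgradient w c (c + ε)).mul_const z
  have hmono := intervalIntegral.integral_mono_on hle (habs w) (((i₁.sub i₂).add i₃).add i₄)
    fun s hs => kruzhkov_step_le hf hlam hCFL hκ₁ hκ₂ hu₁ hu₂ (hsub hs) w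
  have hsplit := hmono.trans_eq
    (by rw [intervalIntegral.integral_add ((i₁.sub i₂).add i₃) i₄,
      intervalIntegral.integral_add (i₁.sub i₂) i₃, intervalIntegral.integral_sub i₁ i₂,
      intervalIntegral.integral_const_mul, intervalIntegral.integral_add (habs u₁) (habs u₂),
      intervalIntegral.integral_const_mul,
      intervalIntegral.integral_sub (hK κ₂ hκ₂ u₂) (hK κ₁ hκ₁ u₁),
      intervalIntegral.integral_const_mul, intervalIntegral.integral_mul_const,
      intervalIntegral.integral_mul_const])
  rw [← forwardMean_subgradient]
  simp only [forwardMean]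
  refine (mul_le_mul_of_nonneg_left hsplit (inv_pos.2 hε).le).trans_eq (by ring)

/-- The Kruzhkov entropies `|· - s|` averaged over `s` in `[c, c + ε]`. -/
noncomputable def averagedEntropy {ul uu ε : ℝ} (hf : IsAffineFlux f B I (Icc ul uu) l L)
    (hlam : 0 ≤ lam) (hCFL : lam * l ≤ 1 / 2) (hε : 0 < ε) (hsub : Icc c (c + ε) ⊆ Icc ul uu) :
    DiscreteEntropy f I (Icc ul uu) lam (2 / ε) where
  entropy v := forwardMean c ε fun s => |v - s|
  flux κ v := forwardMean c ε fun s => kruzhkovFlux (f κ) s v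
  subgradient v := (|v - c| - |v - (c + ε)|) / ε
  source := forwardMean c ε fun s => |B s|
  source_nonneg := mul_nonneg (inv_pos.2 hε).le
    (intervalIntegral.integral_nonneg (by linarith) fun s _ => abs_nonneg _)
  abs_subgradient_le v := by
    rw [abs_div, abs_of_pos hε, div_le_one hε]
    refine (abs_abs_sub_abs_le _ _).trans_eq ?_
    rw [sub_sub_sub_cancel_left, add_sub_cancel_left, abs_of_pos hε]
  abs_subgradient_sub_le v w := by
    have h₁ := abs_abs_sub_abs_le (v - c) (w - c)
    have h₂ := abs_abs_sub_abs_le (v - (c + ε)) (w - (c + ε))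
    rw [sub_sub_sub_cancel_right] at h₁ h₂
    rw [← sub_div, abs_div, abs_of_pos hε, div_mul_eq_mul_div, sub_sub_sub_comm]
    exact div_le_div_of_nonneg_right ((abs_sub _ _).trans (by linarith)) hε.le
  step_le _ hκ₁ _ hκ₂ _ hu₁ _ hu₂ w :=
    forwardMean_kruzhkov_step_le hf hlam hCFL hε hsub hκ₁ hκ₂ hu₁ hu₂ w

theorem averagedEntropy_approximates {ul uu ε : ℝ} (hf : IsAffineFlux f B I (Icc ul uu) l L)
    (hlam : 0 ≤ lam) (hCFL : lam * l ≤ 1 / 2) (hε : 0 < ε) (hsub : Icc c (c + ε) ⊆ Icc ul uu) :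
    (averagedEntropy hf hlam hCFL hε hsub).Approximates B c ((1 + |l| + |L|) * ε) := by
  have hc : c ∈ Icc c (c + ε) := ⟨le_rfl, by linarith⟩
  have hmean : ∀ (g : ℝ → ℝ) (C : ℝ), C ≤ 1 + |l| + |L| →
      (∀ s ∈ Icc ul uu, ∀ r ∈ Icc ul uu, |g s - g r| ≤ C * |s - r|) →
      |forwardMean c ε g - g c| ≤ (1 + |l| + |L|) * ε := by
    intro g C hC hg
    refine abs_forwardMean_sub_le hε ((continuousOn_of_abs_sub_le hg).mono hsub) _ fun s hs =>
      (hg s (hsub hs) c (hsub hc)).trans (mul_le_mul hC ?_ (abs_nonneg _) (by positivity))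
    rw [abs_of_nonneg (sub_nonneg.2 hs.1)]
    linarith [hs.2]
  refine ⟨fun v _ => hmean (fun s => |v - s|) 1 (by linarith [abs_nonneg l, abs_nonneg L])
      fun s _ r _ => ?_, fun κ hκ v _ => hmean (fun s => kruzhkovFlux (f κ) s v) l
      (by linarith [le_abs_self l, abs_nonneg L]) (hf.abs_kruzhkovFlux_param_sub_le hκ v),
    hmean (fun s => |B s|) L (by linarith [le_abs_self L, abs_nonneg l]) fun s hs r hr =>
      (abs_abs_sub_abs_le _ _).trans (hf.abs_slope_sub_le s hs r hr)⟩
  rw [one_mul]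
  refine (abs_abs_sub_abs_le _ _).trans_eq ?_
  rw [sub_sub_sub_cancel_left, abs_sub_comm]

theorem exists_discreteEntropy_approximates {ul uu : ℝ} (hf : IsAffineFlux f B I (Icc ul uu) l L)
    (hlam : 0 ≤ lam) (hCFL : lam * l ≤ 1 / 2) (c : ℝ) :
    ∃ ε₀ > 0, ∀ ε > 0, ε ≤ ε₀ → ∃ E : DiscreteEntropy f I (Icc ul uu) lam (2 / ε),
      E.Approximates B c ((1 + |l| + |L|) * ε) := by
  rcases lt_or_ge c ul with hc | hc
  · refine ⟨1, one_pos, fun ε hε _ => ⟨linearEntropy hf hlam c abs_one (by positivity),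
      linearEntropy_approximates hf hlam _ _ (fun v hv => Or.inl ?_) (by positivity)⟩⟩
    exact Real.sign_of_pos (sub_pos.2 (hc.trans_le hv.1))
  rcases le_or_gt uu c with hc' | hc'
  · refine ⟨1, one_pos, fun ε hε _ => ⟨linearEntropy hf hlam c (σ := -1) (by simp) (by positivity),
      linearEntropy_approximates hf hlam _ _ (fun v hv => ?_) (by positivity)⟩⟩
    exact (hv.2.trans hc').lt_or_eq.imp_left fun h => Real.sign_of_neg (sub_neg.2 h)
  · refine ⟨uu - c, sub_pos.2 hc', fun ε hε hε' => ?_⟩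
    have hsub : Icc c (c + ε) ⊆ Icc ul uu := Icc_subset_Icc hc (by linarith)
    exact ⟨_, averagedEntropy_approximates hf hlam hCFL hε hsub⟩

end DiscreteEntropy

/-- The rectangle whose translates by half a mesh width to the left and to the right lie in the
cells `i` and `i + 2` of level `n`. -/
def stencilCell (dx dt : ℝ) (n : ℕ) (i : ℤ) : Set (ℝ × ℝ) :=
  Ico ((i : ℝ) * dx / 2) (((i : ℝ) + 2) * dx / 2) ×ˢ Ico (n * dt) ((n + 1) * dt)

theorem measurableSet_stencilCell (dx dt : ℝ) (n : ℕ) (i : ℤ) :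
    MeasurableSet (stencilCell dx dt n i) :=
  measurableSet_Ico.prod measurableSet_Ico

theorem volume_stencilCell_ne_top (dx dt : ℝ) (n : ℕ) (i : ℤ) :
    volume (stencilCell dx dt n i) ≠ ⊤ := by
  rw [stencilCell, Measure.volume_eq_prod, Measure.prod_prod]
  exact ENNReal.mul_ne_top measure_Ico_lt_top.ne measure_Ico_lt_top.ne

theorem volume_real_stencilCell {dx dt : ℝ} (hdx : 0 ≤ dx) (hdt : 0 ≤ dt) (n : ℕ) (i : ℤ) :
    volume.real (stencilCell dx dt n i) = dx * dt := by
  rw [stencilCell, Measure.volume_eq_prod, measureReal_prod_prod,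
    Real.volume_real_Ico_of_le (by linarith), Real.volume_real_Ico_of_le (by linarith)]
  ring

/-- The function of `(x, t)` whose value on a stencil cell is the summand of `cubicSum` attached
to that cell, and whose integral is therefore `dt * cubicSum dx dt U X T`. -/
noncomputable def cubicDensity (dx dt : ℝ) (U : ℕ → ℤ → ℝ) (X T : ℝ) (p : ℝ × ℝ) : ℝ :=
  ∑ n ∈ Finset.range (⌊T / dt⌋₊ + 1),
    ∑ i ∈ (Finset.Icc (-(2 * (⌊X / dx⌋ + 1))) (2 * (⌊X / dx⌋ + 1))).filter
      (fun i : ℤ => Even (i + (n : ℤ))),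
      (stencilCell dx dt n i).indicator (fun _ => |U n (i + 2) - U n i| ^ 3) p

section CubicDensity

variable {dx dt : ℝ} (U : ℕ → ℤ → ℝ) (X T : ℝ)

theorem integrable_indicator_stencilCell (dx dt : ℝ) (n : ℕ) (i : ℤ) (r : ℝ) :
    Integrable ((stencilCell dx dt n i).indicator fun _ => r) :=
  (integrable_indicator_iff (measurableSet_stencilCell _ _ _ _)).2
    (integrableOn_const (volume_stencilCell_ne_top _ _ _ _))

theorem integrable_cubicDensity : Integrable (cubicDensity dx dt U X T) :=
  integrable_finsetSum _ fun _ _ => integrable_finsetSum _ fun _ _ =>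
    integrable_indicator_stencilCell _ _ _ _ _

theorem cubicDensity_nonneg (p : ℝ × ℝ) : 0 ≤ cubicDensity dx dt U X T p :=
  Finset.sum_nonneg fun _ _ => Finset.sum_nonneg fun _ _ =>
    indicator_nonneg (fun _ _ => by positivity) _

theorem integral_cubicDensity (hdx : 0 ≤ dx) (hdt : 0 ≤ dt) :
    ∫ p, cubicDensity dx dt U X T p = dt * cubicSum dx dt U X T := by
  have hcell (n : ℕ) (i : ℤ) : ∫ p, (stencilCell dx dt n i).indicator
      (fun _ => |U n (i + 2) - U n i| ^ 3) p = dt * (dx * |U n (i + 2) - U n i| ^ 3) := by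
    rw [integral_indicator (measurableSet_stencilCell _ _ _ _), setIntegral_const,
      volume_real_stencilCell hdx hdt, smul_eq_mul]
    ring
  unfold cubicDensity cubicSum
  rw [integral_finsetSum _ fun _ _ => integrable_finsetSum _ fun _ _ =>
    integrable_indicator_stencilCell _ _ _ _ _]
  simp_rw [integral_finsetSum _ fun _ _ => integrable_indicator_stencilCell _ _ _ _ _, hcell,
    Finset.mul_sum]

variable {X T}

theorem abs_gridFun_jump_pow_three_le_cubicDensity (hdx : 0 < dx) (hdt : 0 < dt) {p : ℝ × ℝ}
    (hp : 0 ≤ p.2) (hX : |p.1| + dx ≤ X) (hT : p.2 ≤ T) :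
    |gridFun dx dt U (p + (dx / 2, 0)) - gridFun dx dt U (p + (-(dx / 2), 0))| ^ 3 ≤
      cubicDensity dx dt U X T p := by
  obtain ⟨n, i, heven, hn, hi, hgrid⟩ := exists_stencil hdx hdt hp
  rw [(hgrid U).1, (hgrid U).2.1]
  have hn_mem : n ∈ Finset.range (⌊T / dt⌋₊ + 1) := by
    rw [Finset.mem_range, Nat.lt_succ_iff]
    exact Nat.le_floor ((le_div_iff₀ hdt).2 (hn.1.trans hT))
  have hi_mem : i ∈ (Finset.Icc (-(2 * (⌊X / dx⌋ + 1))) (2 * (⌊X / dx⌋ + 1))).filter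
      (fun i : ℤ => Even (i + (n : ℤ))) := by
    have hXdx : X < (⌊X / dx⌋ + 1) * dx := (div_lt_iff₀ hdx).1 (Int.lt_floor_add_one _)
    have hlower : -(2 * (⌊X / dx⌋ + 1) : ℝ) ≤ i :=
      le_of_mul_le_mul_right (by nlinarith [hi.2, neg_abs_le p.1]) hdx
    have hupper : (i : ℝ) ≤ 2 * (⌊X / dx⌋ + 1) :=
      le_of_mul_le_mul_right (by nlinarith [hi.1, le_abs_self p.1]) hdx
    exact Finset.mem_filter.2
      ⟨Finset.mem_Icc.2 ⟨by exact_mod_cast hlower, by exact_mod_cast hupper⟩, heven⟩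
  have hcell : p ∈ stencilCell dx dt n i := ⟨hi, hn⟩
  have hnonneg (n : ℕ) (i : ℤ) : 0 ≤ (stencilCell dx dt n i).indicator
      (fun _ => |U n (i + 2) - U n i| ^ 3) p := indicator_nonneg (fun _ _ => by positivity) _
  rw [← indicator_of_mem hcell fun _ => |U n (i + 2) - U n i| ^ 3]
  refine (Finset.single_le_sum (f := fun i => (stencilCell dx dt n i).indicator
    (fun _ => |U n (i + 2) - U n i| ^ 3) p) (fun i _ => hnonneg n i) hi_mem).trans ?_
  exact Finset.single_le_sum (f := fun n : ℕ => ∑ i ∈ Finset.filter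
    (fun i : ℤ => Even (i + (n : ℤ))) _, (stencilCell dx dt n i).indicator
    (fun _ => |U n (i + 2) - U n i| ^ 3) p)
    (fun n _ => Finset.sum_nonneg fun i _ => hnonneg n i) hn_mem

end CubicDensity

theorem le_add_cube_div_sq {y τ : ℝ} (hy : 0 ≤ y) (hτ : 0 < τ) : y ≤ τ + y ^ 3 / τ ^ 2 := by
  rcases le_total y τ with h | h
  · have : 0 ≤ y ^ 3 / τ ^ 2 := by positivity
    linarith
  · have : y ≤ y ^ 3 / τ ^ 2 := by
      rw [le_div_iff₀ (by positivity)]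
      nlinarith [mul_le_mul_of_nonneg_left (pow_le_pow_left₀ hτ.le h 2) hy]
    linarith

theorem setIntegral_halfPlane_mul_translate_sub {b w : ℝ × ℝ → ℝ} {A : ℝ} (hb : Measurable b)
    (hbA : ∀ q, |b q| ≤ A) (hw : Integrable w) (h r : ℝ) :
    ∫ q in halfPlane, (b (q + (-h, 0)) - b (q + (h, 0))) * w (q + (0, r)) =
      ∫ q in halfPlane, b q * (w (q + (h, r)) - w (q + (-h, r))) := by
  have hint (v z : ℝ × ℝ) : IntegrableOn (fun q => b (q + v) * w (q + z)) halfPlane :=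
    ((hw.comp_add_right z).bdd_mul (hb.comp (measurable_add_const v)).aestronglyMeasurable
      (Eventually.of_forall fun q => hbA _)).integrableOn
  have htranslate (s : ℝ) : ∫ q in halfPlane, b (q + (s, 0)) * w (q + (0, r)) =
      ∫ q in halfPlane, b (q + 0) * w (q + (-s, r)) := by
    rw [← setIntegral_halfPlane_comp_add (fun q => b (q + 0) * w (q + (-s, r))) s 0]
    simp only [add_assoc, Prod.mk_add_mk, add_neg_cancel, zero_add, add_zero]
  simp_rw [sub_mul, mul_sub]
  rw [integral_sub (hint _ _) (hint _ _), htranslate, htranslate, neg_neg,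
    ← integral_sub (hint _ _) (hint _ _)]
  simp_rw [add_zero]

theorem setIntegral_halfPlane_mul_translate_sub_le {b w F : ℝ × ℝ → ℝ} {A h r : ℝ}
    (hb : Measurable b) (hbA : ∀ q, |b q| ≤ A) (hw : Integrable w) (hF : Integrable F)
    (hF_nonneg : ∀ q, 0 ≤ F q) (hr : 0 ≤ r)
    (hwF : ∀ q ∈ halfPlane, |w (q + (h, 0)) - w (q + (-h, 0))| ≤ F q) :
    ∫ q in halfPlane, (b (q + (-h, 0)) - b (q + (h, 0))) * w (q + (0, r)) ≤ A * ∫ q, F q := by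
  have hA : 0 ≤ A := (abs_nonneg _).trans (hbA 0)
  rw [setIntegral_halfPlane_mul_translate_sub hb hbA hw]
  calc ∫ q in halfPlane, b q * (w (q + (h, r)) - w (q + (-h, r)))
      ≤ ∫ q in halfPlane, A * F (q + (0, r)) := by
        refine setIntegral_mono_on ?_ ((hF.comp_add_right _).const_mul A).integrableOn
          (measurableSet_le_snd 0) fun q hq => ?_
        · exact (((hw.comp_add_right _).sub (hw.comp_add_right _)).bdd_mul hb.aestronglyMeasurable
            (Eventually.of_forall hbA)).integrableOn
        · have hbound := hwF (q + (0, r)) (add_nonneg hq hr)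
          simp only [add_assoc, Prod.mk_add_mk, zero_add, add_zero] at hbound
          refine (le_abs_self _).trans ?_
          rw [abs_mul]
          exact mul_le_mul (hbA q) hbound (abs_nonneg _) hA
    _ = A * ∫ q in {q : ℝ × ℝ | r ≤ q.2}, F q := by
        rw [integral_const_mul, setIntegral_halfPlane_comp_add F]
    _ ≤ A * ∫ q, F q :=
        mul_le_mul_of_nonneg_left (setIntegral_le_integral hF (Eventually.of_forall hF_nonneg)) hA

theorem exists_abs_translate_le_indicator {φ : ℝ × ℝ → ℝ} (hφ : ContDiff ℝ 1 φ)
    (hφc : HasCompactSupport φ) (H : ℝ) :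
    ∃ C R : ℝ, 0 ≤ C ∧ 0 < R ∧ ∀ r, 0 ≤ r → r ≤ H → ∀ q : ℝ × ℝ,
      |φ (q + (r / 2, 0))| ≤ (Metric.closedBall 0 R).indicator (fun _ => C) q ∧
      |φ (q + (r / 2, 0)) - φ (q + (-(r / 2), 0))| ≤
        (Metric.closedBall 0 R).indicator (fun _ => C) q * r := by
  obtain ⟨L, hL⟩ := hφ.lipschitzWith_of_hasCompactSupport hφc one_ne_zero
  obtain ⟨M, hM⟩ := hφc.exists_bound_of_continuous hφ.continuous
  obtain ⟨R, hR⟩ := hφc.isCompact.isBounded.subset_closedBall (0 : ℝ × ℝ)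
  obtain ⟨R', hRR', hR'⟩ : ∃ R', R + H ≤ R' ∧ 0 < R' :=
    ⟨max (R + H) 1, le_max_left _ _, lt_max_of_lt_right one_pos⟩
  refine ⟨max M L, R', le_max_of_le_right L.2, hR', fun r hr hrH q => ?_⟩
  by_cases hq : q ∈ Metric.closedBall (0 : ℝ × ℝ) R'
  · rw [indicator_of_mem hq]
    refine ⟨(hM _).trans (le_max_left _ _), (hL.norm_sub_le _ _).trans ?_⟩
    rw [add_sub_add_left_eq_sub, Prod.mk_sub_mk, sub_neg_eq_add, add_halves, sub_zero,
      Prod.norm_mk, norm_zero, Real.norm_of_nonneg hr, max_eq_left hr]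
    gcongr
    exact le_max_right _ _
  · have hzero (s : ℝ) (hs : |s| ≤ H) : φ (q + (s, 0)) = 0 := by
      refine image_eq_zero_of_notMem_tsupport fun hmem => hq ?_
      rw [mem_closedBall_zero_iff]
      have hshift : ‖((s, 0) : ℝ × ℝ)‖ ≤ H := by simpa using hs
      have htri := norm_sub_le (q + (s, 0)) (s, 0)
      rw [add_sub_cancel_right] at htri
      linarith [mem_closedBall_zero_iff.1 (hR hmem)]
    have hhalf : |r / 2| ≤ H := by rw [abs_of_nonneg (by linarith)]; linarith
    rw [indicator_of_notMem hq, hzero _ hhalf, hzero _ (by rwa [abs_neg])]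
    simp

section Corrector

variable {φ : ℝ × ℝ → ℝ} {σ : ℝ → ℝ} {l τ : ℝ}

theorem abs_mul_sub_mul_le_of_lipschitz (hσ : ∀ v, |σ v| ≤ 1)
    (hσl : ∀ v w, |σ v - σ w| ≤ l * |v - w|) (hl : 0 ≤ l) (hτ : 0 < τ) (v w r s : ℝ) :
    |σ v * r - σ w * s| ≤ l * (τ + |v - w| ^ 3 / τ ^ 2) * |r| + |r - s| := by
  calc |σ v * r - σ w * s| = |(σ v - σ w) * r + σ w * (r - s)| := by ring_nf
    _ ≤ |σ v - σ w| * |r| + |σ w| * |r - s| := by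
        simpa only [abs_mul] using abs_add_le ((σ v - σ w) * r) (σ w * (r - s))
    _ ≤ l * |v - w| * |r| + 1 * |r - s| := by gcongr <;> [exact hσl v w; exact hσ w]
    _ ≤ l * (τ + |v - w| ^ 3 / τ ^ 2) * |r| + |r - s| := by
        rw [one_mul]
        gcongr
        exact le_add_cube_div_sq (abs_nonneg _) hτ

theorem exists_abs_translate_sub_le (hφ : ContDiff ℝ 1 φ) (hφc : HasCompactSupport φ) (H : ℝ) :
    ∃ C R : ℝ, 0 ≤ C ∧ 0 < R ∧ ∀ {dx dt : ℝ}, 0 < dx → dx ≤ H → 0 < dt →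
      ∀ (U : ℕ → ℤ → ℝ) {σ : ℝ → ℝ} {l τ : ℝ}, (∀ v, |σ v| ≤ 1) →
      (∀ v w, |σ v - σ w| ≤ l * |v - w|) → 0 ≤ l → 0 < τ → ∀ q ∈ halfPlane,
      |σ (gridFun dx dt U (q + (dx / 2, 0))) * φ (q + (dx / 2, 0)) -
        σ (gridFun dx dt U (q + (-(dx / 2), 0))) * φ (q + (-(dx / 2), 0))| ≤
      C * (l * ((Metric.closedBall 0 R).indicator (fun _ => τ) q +
          cubicDensity dx dt U (R + H) R q / τ ^ 2) +
        (Metric.closedBall 0 R).indicator (fun _ => dx) q) := by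
  obtain ⟨C, R, hC, hR, hCR⟩ := exists_abs_translate_le_indicator hφ hφc H
  refine ⟨C, R, hC, hR, fun {dx dt} hdx hdxH hdt U {σ l τ} hσ hσl hl hτ q hq => ?_⟩
  obtain ⟨hφq, hφdiff⟩ := hCR dx hdx.le hdxH q
  refine (abs_mul_sub_mul_le_of_lipschitz hσ hσl hl hτ _ _ _ _).trans ?_
  have hdensity := cubicDensity_nonneg (dx := dx) (dt := dt) U (R + H) R q
  by_cases hqR : q ∈ Metric.closedBall (0 : ℝ × ℝ) R
  · simp only [indicator_of_mem hqR] at hφq hφdiff ⊢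
    rw [mem_closedBall_zero_iff] at hqR
    have hjump := abs_gridFun_jump_pow_three_le_cubicDensity U hdx hdt hq (X := R + H) (T := R)
      (by linarith [(norm_fst_le q).trans hqR, Real.norm_eq_abs q.1])
      ((le_abs_self _).trans ((norm_snd_le q).trans hqR))
    calc _ ≤ l * (τ + cubicDensity dx dt U (R + H) R q / τ ^ 2) * C + C * dx := by gcongr
      _ = _ := by ring
  · simp only [indicator_of_notMem hqR, zero_mul, abs_nonpos_iff] at hφq hφdiff ⊢
    rw [hφdiff, hφq, abs_zero, mul_zero, zero_add]
    positivity

theorem exists_setIntegral_corrector_le (hφ : ContDiff ℝ 1 φ) (hφc : HasCompactSupport φ) (H : ℝ) :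
    ∃ C R : ℝ, 0 ≤ C ∧ 0 < R ∧ ∀ {dx dt : ℝ}, 0 < dx → dx ≤ H → 0 < dt →
      ∀ (U : ℕ → ℤ → ℝ) {b : ℝ × ℝ → ℝ} {A : ℝ}, Measurable b → (∀ q, |b q| ≤ A) →
      ∀ {σ : ℝ → ℝ} {l τ : ℝ}, Measurable σ → (∀ v, |σ v| ≤ 1) →
      (∀ v w, |σ v - σ w| ≤ l * |v - w|) → 0 ≤ l → 0 < τ →
      ∫ q in halfPlane, (b (q + (-(dx / 2), 0)) - b (q + (dx / 2, 0))) *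
          (σ (gridFun dx dt U (q + (0, dt))) * φ (q + (0, dt))) ≤
        C * A * (l * (τ + dt * cubicSum dx dt U (R + H) R / τ ^ 2) + dx) := by
  obtain ⟨C, R, hC, hR, hCR⟩ := exists_abs_translate_sub_le hφ hφc H
  set B := Metric.closedBall (0 : ℝ × ℝ) R
  refine ⟨C * (volume.real B + 1), R, by positivity, hR,
    fun {dx dt} hdx hdxH hdt U {b A} hb hbA {σ l τ} hσm hσ hσl hl hτ => ?_⟩
  have hA : 0 ≤ A := (abs_nonneg _).trans (hbA 0)
  have hball (r : ℝ) : Integrable (B.indicator fun _ => r) :=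
    (integrable_indicator_iff measurableSet_closedBall).2
      (integrableOn_const measure_closedBall_lt_top.ne)
  have hball_integral (r : ℝ) : ∫ q, B.indicator (fun _ => r) q = volume.real B * r := by
    rw [integral_indicator measurableSet_closedBall, setIntegral_const, smul_eq_mul]
  have hball_nonneg {r : ℝ} (hr : 0 ≤ r) (q : ℝ × ℝ) : 0 ≤ B.indicator (fun _ => r) q :=
    indicator_nonneg (fun _ _ => hr) q
  have hdensity := (integrable_cubicDensity (dx := dx) (dt := dt) U (R + H) R).div_const (τ ^ 2)
  have hfirst : Integrable fun q => l * (B.indicator (fun _ => τ) q +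
      cubicDensity dx dt U (R + H) R q / τ ^ 2) := ((hball τ).add hdensity).const_mul l
  have hw : Integrable fun q => σ (gridFun dx dt U q) * φ q :=
    (hφ.continuous.integrable_of_hasCompactSupport hφc).bdd_mul
      (hσm.comp (measurable_gridFun dx dt U)).aestronglyMeasurable
      (Eventually.of_forall fun q => hσ _)
  refine (setIntegral_halfPlane_mul_translate_sub_le hb hbA hw
    ((hfirst.add (hball dx)).const_mul C) (fun q => ?_) hdt.le
    (hCR hdx hdxH hdt U hσ hσl hl hτ)).trans ?_
  · have := cubicDensity_nonneg (dx := dx) (dt := dt) U (R + H) R q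
    exact mul_nonneg hC (add_nonneg (mul_nonneg hl (add_nonneg (hball_nonneg hτ.le q)
      (by positivity))) (hball_nonneg hdx.le q))
  · rw [integral_const_mul, integral_add' hfirst (hball dx), integral_const_mul,
      integral_add (hball τ) hdensity, integral_div, integral_cubicDensity _ _ _ hdx.le hdt.le,
      hball_integral, hball_integral]
    have hcubic : 0 ≤ cubicSum dx dt U (R + H) R := by unfold cubicSum; positivity
    rw [← sub_nonneg]
    calc
      0 ≤ C * A * (l * (τ + volume.real B * (dt * cubicSum dx dt U (R + H) R / τ ^ 2)) + dx) := by
          positivity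
      _ = _ := by ring

end Corrector

theorem tendsto_corrector_rate {dx ε : ℕ → ℝ} {β : ℝ} (hpos : ∀ m, 0 < dx m)
    (hdx : Tendsto dx atTop (𝓝 0)) (hβ : 0 < β) (hε : ∀ᶠ m in atTop, ε m = dx m ^ β)
    (C K N : ℝ) :
    Tendsto (fun m => (dx m)⁻¹ * (C * (K * dx m ^ (2 / 3 + 2 * β)) *
      (2 / ε m * (dx m ^ (1 / 3 : ℝ) + dx m * N / (dx m ^ (1 / 3 : ℝ)) ^ 2) + dx m))) atTop
      (𝓝 0) := by
  have htendsto {γ : ℝ} (hγ : 0 < γ) : Tendsto (fun m => dx m ^ γ) atTop (𝓝 0) := by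
    simpa only [Real.zero_rpow hγ.ne'] using hdx.rpow_const (Or.inr hγ.le)
  have hlim := (((htendsto hβ).const_mul (2 * (1 + N))).add
    (htendsto (γ := 2 / 3 + 2 * β) (by positivity))).const_mul (C * K)
  simp only [mul_zero, add_zero] at hlim
  refine hlim.congr' ?_
  filter_upwards [hε] with m hm
  have hx := hpos m
  rw [hm]
  generalize dx m = x at hx ⊢
  have hroot : 0 < x ^ (1 / 3 : ℝ) := Real.rpow_pos_of_pos hx _
  have hpow : 0 < x ^ β := Real.rpow_pos_of_pos hx _
  have hrate : x ^ (2 / 3 + 2 * β) = (x ^ (1 / 3 : ℝ)) ^ 2 * (x ^ β) ^ 2 := by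
    rw [Real.rpow_add hx, ← Real.rpow_natCast, ← Real.rpow_natCast, ← Real.rpow_mul hx.le,
      ← Real.rpow_mul hx.le]
    congr 2 <;> push_cast <;> ring
  have hcube : x = (x ^ (1 / 3 : ℝ)) ^ 3 := by
    rw [← Real.rpow_natCast, ← Real.rpow_mul hx.le]
    norm_num
  rw [hrate]
  generalize x ^ (1 / 3 : ℝ) = s at *
  generalize x ^ β = b at *
  subst hcube
  field_simp

section KruzhkovLimit

variable {f : ℝ → ℝ → ℝ} {B : ℝ → ℝ} {I S : Set ℝ} {l L lam c : ℝ}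

theorem IsAffineFlux.kruzhkovFlux_sub_eq (hf : IsAffineFlux f B I S l L) {κ κ₀ : ℝ} (hκ : κ ∈ I)
    (hκ₀ : κ₀ ∈ I) (c w : ℝ) : kruzhkovFlux (f κ) c w - kruzhkovFlux (f κ₀) c w =
      (κ - κ₀) * kruzhkovFlux B c w := by
  simp only [kruzhkovFlux]
  linear_combination Real.sign (w - c) * (hf.sub_eq κ₀ hκ₀ κ hκ w - hf.sub_eq κ₀ hκ₀ κ hκ c)

theorem IsAffineFlux.abs_kruzhkovFlux_sub_le [S.OrdConnected] (hf : IsAffineFlux f B I S l L)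
    {κ κ₀ v w : ℝ} (hκ : κ ∈ I) (hκ₀ : κ₀ ∈ I) (hv : v ∈ S) (hw : w ∈ S) (c : ℝ) :
    |kruzhkovFlux (f κ) c v - kruzhkovFlux (f κ₀) c w| ≤
      l * |v - w| + |κ - κ₀| * |kruzhkovFlux B c w| := by
  rw [← abs_mul, ← hf.kruzhkovFlux_sub_eq hκ hκ₀]
  exact (_root_.abs_sub_le _ _ _).trans
    (add_le_add_left (_root_.abs_kruzhkovFlux_sub_le (hf.abs_sub_le κ hκ) hv hw c) _)

theorem IsAffineFlux.continuousOn_kruzhkovFlux [S.OrdConnected] (hf : IsAffineFlux f B I S l L)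
    (c : ℝ) : ContinuousOn (fun p : ℝ × ℝ => kruzhkovFlux (f p.1) c p.2) (I ×ˢ S) := by
  intro p₀ hp₀
  refine tendsto_iff_dist_tendsto_zero.2 (squeeze_zero' (Eventually.of_forall fun _ => dist_nonneg)
    (eventually_mem_nhdsWithin.mono fun p hp =>
      hf.abs_kruzhkovFlux_sub_le hp.1 hp₀.1 hp.2 hp₀.2 c) ?_)
  have hcont : Continuous fun p : ℝ × ℝ =>
      l * |p.2 - p₀.2| + |p.1 - p₀.1| * |kruzhkovFlux B c p₀.2| := by fun_prop
  simpa using hcont.continuousWithinAt.tendsto (x := p₀) (s := I ×ˢ S)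

theorem exists_abs_discreteEntropy_le (hI : IsCompact I) (hS : IsCompact S) [S.OrdConnected]
    (hf : IsAffineFlux f B I S l L) (c δ₀ : ℝ) :
    ∃ M, ∀ {lam L' δ : ℝ} {E : DiscreteEntropy f I S lam L'},
      E.Approximates B c δ → δ ≤ δ₀ → (∀ v ∈ S, |E.entropy v| ≤ M) ∧
        (∀ κ ∈ I, ∀ v ∈ S, |E.flux κ v| ≤ M) ∧ E.source ≤ M := by
  obtain ⟨Mη, hMη⟩ := hS.exists_bound_of_continuousOn (f := fun v => |v - c|) (by fun_prop)
  obtain ⟨Mq, hMq⟩ := (hI.prod hS).exists_bound_of_continuousOn (hf.continuousOn_kruzhkovFlux c)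
  simp only [Real.norm_eq_abs] at hMη hMq
  refine ⟨max (max Mη Mq) |B c| + δ₀, fun {lam L' δ E} hE hδ => ⟨fun v hv => ?_,
    fun κ hκ v hv => ?_, ?_⟩⟩
  · linarith [abs_sub_abs_le_abs_sub (E.entropy v) |v - c|, hE.abs_entropy_sub_le v hv,
      hMη v hv, le_max_left (max Mη Mq) |B c|, le_max_left Mη Mq]
  · linarith [abs_sub_abs_le_abs_sub (E.flux κ v) (kruzhkovFlux (f κ) c v),
      hE.abs_flux_sub_le κ hκ v hv, hMq (κ, v) ⟨hκ, hv⟩, le_max_left (max Mη Mq) |B c|,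
      le_max_right Mη Mq]
  · linarith [le_abs_self (E.source - (|B c|)), hE.abs_source_sub_le,
      le_max_right (max Mη Mq) |B c|]

variable {L' δ : ℕ → ℝ} {E : ∀ m, DiscreteEntropy f I S lam (L' m)}

theorem tendsto_of_abs_sub_le_of_tendsto {g g' : ℕ → ℝ} {y : ℝ} (hδ : Tendsto δ atTop (𝓝 0))
    (h : ∀ m, |g m - g' m| ≤ δ m) (hg' : Tendsto g' atTop (𝓝 y)) : Tendsto g atTop (𝓝 y) := by
  simpa only [sub_add_cancel, zero_add] using (squeeze_zero_norm h hδ).add hg'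

theorem tendsto_discreteEntropy_entropy (hE : ∀ m, (E m).Approximates B c (δ m))
    (hδ : Tendsto δ atTop (𝓝 0)) {v : ℕ → ℝ} {v₀ : ℝ} (hv : ∀ m, v m ∈ S)
    (hlim : Tendsto v atTop (𝓝 v₀)) :
    Tendsto (fun m => (E m).entropy (v m)) atTop (𝓝 |v₀ - c|) :=
  tendsto_of_abs_sub_le_of_tendsto hδ (fun m => (hE m).abs_entropy_sub_le _ (hv m))
    (hlim.sub_const c).abs

theorem tendsto_discreteEntropy_source (hE : ∀ m, (E m).Approximates B c (δ m))
    (hδ : Tendsto δ atTop (𝓝 0)) : Tendsto (fun m => (E m).source) atTop (𝓝 |B c|) :=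
  tendsto_of_abs_sub_le_of_tendsto hδ (fun m => (hE m).abs_source_sub_le) tendsto_const_nhds

theorem tendsto_discreteEntropy_flux [S.OrdConnected] (hf : IsAffineFlux f B I S l L)
    (hE : ∀ m, (E m).Approximates B c (δ m)) (hδ : Tendsto δ atTop (𝓝 0)) {κ v : ℕ → ℝ}
    {κ₀ v₀ : ℝ} (hκ : ∀ m, κ m ∈ I) (hκ₀ : κ₀ ∈ I) (hv : ∀ m, v m ∈ S) (hv₀ : v₀ ∈ S)
    (hκlim : Tendsto κ atTop (𝓝 κ₀)) (hvlim : Tendsto v atTop (𝓝 v₀)) :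
    Tendsto (fun m => (E m).flux (κ m) (v m)) atTop (𝓝 (kruzhkovFlux (f κ₀) c v₀)) := by
  exact tendsto_of_abs_sub_le_of_tendsto hδ (fun m => (hE m).abs_flux_sub_le _ (hκ m) _ (hv m))
    ((hf.continuousOn_kruzhkovFlux c (κ₀, v₀) ⟨hκ₀, hv₀⟩).tendsto.comp (tendsto_nhdsWithin_iff.2
      ⟨hκlim.prodMk_nhds hvlim, Eventually.of_forall fun m => ⟨hκ m, hv m⟩⟩))

theorem exists_discreteEntropy_seq {ul uu : ℝ} (hf : IsAffineFlux f B I (Icc ul uu) l L)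
    (hlam : 0 ≤ lam) (hCFL : lam * l ≤ 1 / 2) (c : ℝ) {ρ : ℕ → ℝ} (hρ : ∀ m, 0 < ρ m)
    (hρlim : Tendsto ρ atTop (𝓝 0)) :
    ∃ (ε δ : ℕ → ℝ) (E : ∀ m, DiscreteEntropy f I (Icc ul uu) lam (2 / ε m)),
      (∀ m, 0 < ε m) ∧ (∀ᶠ m in atTop, ε m = ρ m) ∧ Tendsto δ atTop (𝓝 0) ∧
        ∀ m, (E m).Approximates B c (δ m) := by
  obtain ⟨ε₀, hε₀, h⟩ := exists_discreteEntropy_approximates hf hlam hCFL c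
  have hε : ∀ m, 0 < min (ρ m) ε₀ := fun m => lt_min (hρ m) hε₀
  have hε_eq : ∀ᶠ m in atTop, min (ρ m) ε₀ = ρ m :=
    (hρlim.eventually_le_const hε₀).mono fun m hm => min_eq_left hm
  choose E hE using fun m => h _ (hε m) (min_le_right _ _)
  refine ⟨_, _, E, hε, hε_eq, ?_, hE⟩
  simpa using (hρlim.congr' (hε_eq.mono fun m hm => hm.symm)).const_mul (1 + |l| + |L|)

end KruzhkovLimit

section Scheme

variable {f : ℝ → ℝ → ℝ} {k V u0 : ℝ → ℝ} {I S : Set ℝ} {lam dx L : ℝ} {U a : ℕ → ℤ → ℝ}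

/-- The numerical entropy flux of a scheme with coefficient `k`. The increments of `V` are assumed
to dominate those of `k`, so that subtracting `source * V` accounts for the source term. -/
noncomputable def DiscreteEntropy.gridFlux (E : DiscreteEntropy f I S lam L) (k V : ℝ → ℝ)
    (dx : ℝ) (U : ℕ → ℤ → ℝ) (n : ℕ) (i : ℤ) : ℝ :=
  E.flux (cellAverage k dx i) (U n i) - E.source * cellAverage V dx i

theorem IsPredictorCorrector.entropy_step_le (h : IsPredictorCorrector f k u0 lam dx U a)
    (E : DiscreteEntropy f I S lam L) (hlam : 0 ≤ lam) (hk : ∀ i, cellAverage k dx i ∈ I)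
    (hU : ∀ (n : ℕ) (i : ℤ), Even (i + (n : ℤ)) → U n i ∈ S)
    (hV : ∀ i, |cellAverage k dx (i + 2) - cellAverage k dx i| ≤
      cellAverage V dx (i + 2) - cellAverage V dx i) {n : ℕ} {i : ℤ} (hi : Even (i + (n : ℤ))) :
    E.entropy (U (n + 1) (i + 1)) ≤ 1 / 2 * (E.entropy (U n (i + 2)) + E.entropy (U n i)) -
      lam * (E.gridFlux k V dx U n (i + 2) - E.gridFlux k V dx U n i) +
      (a (n + 1) i - a (n + 1) (i + 2)) * E.subgradient (U (n + 1) (i + 1)) := by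
  have hi' : Even (i + 2 + (n : ℤ)) := by
    rw [add_right_comm]
    exact hi.add even_two
  have hstep := E.step_le _ (hk i) _ (hk (i + 2)) _ (hU n i hi) _ (hU n (i + 2) hi')
    (U (n + 1) (i + 1))
  have hcorrection : U (n + 1) (i + 1) - (1 / 2 * (U n i + U n (i + 2)) -
      lam * (f (cellAverage k dx (i + 2)) (U n (i + 2)) - f (cellAverage k dx i) (U n i))) =
      a (n + 1) i - a (n + 1) (i + 2) := by
    rw [h.2 n i hi, laxFriedrichsStep]
    ring
  rw [hcorrection] at hstep
  have hsource := mul_le_mul_of_nonneg_left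
    (mul_le_mul_of_nonneg_left (hV i) E.source_nonneg) hlam
  simp only [DiscreteEntropy.gridFlux]
  linarith

theorem IsPredictorCorrector.gridFun_entropy_step_le
    (h : IsPredictorCorrector f k u0 lam dx U a) (E : DiscreteEntropy f I S lam L)
    (hlam : 0 < lam) (hdx : 0 < dx) (hk : ∀ i, cellAverage k dx i ∈ I)
    (hU : ∀ (n : ℕ) (i : ℤ), Even (i + (n : ℤ)) → U n i ∈ S)
    (hV : ∀ i, |cellAverage k dx (i + 2) - cellAverage k dx i| ≤
      cellAverage V dx (i + 2) - cellAverage V dx i) {p : ℝ × ℝ} (hp : p ∈ halfPlane) :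
    let η := gridFun dx (lam * dx) fun n i => E.entropy (U n i)
    let q := gridFun dx (lam * dx) (E.gridFlux k V dx U)
    let b := gridFun dx (lam * dx) fun n i => a (n + 1) i
    η (p + (0, lam * dx)) ≤ 1 / 2 * (η (p + (dx / 2, 0)) + η (p + (-(dx / 2), 0))) -
      lam * (q (p + (dx / 2, 0)) - q (p + (-(dx / 2), 0))) +
      (b (p + (-(dx / 2), 0)) - b (p + (dx / 2, 0))) *
        E.subgradient (gridFun dx (lam * dx) U (p + (0, lam * dx))) := by
  obtain ⟨n, i, hi, -, -, hg⟩ := exists_stencil hdx (mul_pos hlam hdx) hp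
  simp only [hg]
  exact h.entropy_step_le E hlam.le hk hU hV hi

end Scheme

theorem exists_tendsto_corrector_le {φ : ℝ × ℝ → ℝ} (hφ : ContDiff ℝ 1 φ)
    (hφc : HasCompactSupport φ) {lam β K : ℝ} (hlam : 0 < lam) (hβ : 0 < β) {dx ε : ℕ → ℝ}
    (hpos : ∀ m, 0 < dx m) (hdx : Tendsto dx atTop (𝓝 0)) (hε : ∀ m, 0 < ε m)
    (hε_eq : ∀ᶠ m in atTop, ε m = dx m ^ β) {U : ℕ → ℕ → ℤ → ℝ}
    (hcubic : ∀ X T : ℝ, 0 < X → 0 < T → ∃ C, ∀ m, cubicSum (dx m) (lam * dx m) (U m) X T ≤ C) :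
    ∃ δ : ℕ → ℝ, Tendsto δ atTop (𝓝 0) ∧ ∀ m (b : ℝ × ℝ → ℝ) (σ : ℝ → ℝ), Measurable b →
      (∀ p, |b p| ≤ K * dx m ^ (2 / 3 + 2 * β)) → Measurable σ → (∀ v, |σ v| ≤ 1) →
      (∀ v w, |σ v - σ w| ≤ 2 / ε m * |v - w|) →
      (dx m)⁻¹ * ∫ p in halfPlane, (b (p + (-(dx m / 2), 0)) - b (p + (dx m / 2, 0))) *
        σ (gridFun (dx m) (lam * dx m) (U m) (p + (0, lam * dx m))) *
          φ (p + (0, lam * dx m)) ≤ δ m := by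
  obtain ⟨H, hH⟩ := hdx.bddAbove_range
  replace hH (m : ℕ) : dx m ≤ H := hH (mem_range_self m)
  obtain ⟨C, R, hC, hR, hcorrector⟩ := exists_setIntegral_corrector_le hφ hφc H
  obtain ⟨N, hN⟩ := hcubic (R + H) R (by linarith [hpos 0, hH 0]) hR
  refine ⟨_, tendsto_corrector_rate hpos hdx hβ hε_eq C K (lam * N),
    fun m b σ hb hbK hσm hσ hσl => ?_⟩
  have hx := hpos m
  have hεm := hε m
  have hK : 0 ≤ K * dx m ^ (2 / 3 + 2 * β) := (abs_nonneg _).trans (hbK 0)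
  simp only [mul_assoc (b _ - b _)]
  refine mul_le_mul_of_nonneg_left ((hcorrector hx (hH m) (mul_pos hlam hx) (U m) hb hbK hσm hσ hσl
    (by positivity) (Real.rpow_pos_of_pos hx (1 / 3))).trans ?_) (inv_pos.2 hx).le
  have hdtN := (mul_le_mul_of_nonneg_left (hN m) (mul_pos hlam hx).le).trans_eq
    (by ring : lam * dx m * N = dx m * (lam * N))
  gcongr

section Limit

variable {f : ℝ → ℝ → ℝ} {B k V u0 : ℝ → ℝ} {I S : Set ℝ} {kl ku ul uu l L lam c β K MV : ℝ}
  {dx δ : ℕ → ℝ} {U a : ℕ → ℕ → ℤ → ℝ} {u φ : ℝ × ℝ → ℝ}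

theorem ae_halfPlane_of_ae_fst {P : ℝ → Prop} (h : ∀ᵐ x, P x) :
    ∀ᵐ p ∂(volume : Measure (ℝ × ℝ)).restrict halfPlane, P p.1 := by
  rw [restrict_halfPlane_eq_prod]
  exact Measure.quasiMeasurePreserving_fst.ae h

theorem ae_tendsto_gridFun_gridFlux (hpos : ∀ m, 0 < dx m) (hdx : Tendsto dx atTop (𝓝 0))
    (hf : IsAffineFlux f B I (Icc ul uu) l L) {L' dt : ℕ → ℝ}
    {E : ∀ m, DiscreteEntropy f I (Icc ul uu) lam (L' m)}
    (hE : ∀ m, (E m).Approximates B c (δ m)) (hδ : Tendsto δ atTop (𝓝 0))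
    (hk : LocallyIntegrable k) (hV : LocallyIntegrable V) (hkI : ∀ᵐ x, k x ∈ I)
    (hk_cell : ∀ m i, cellAverage k (dx m) i ∈ I)
    (hU : ∀ (m n : ℕ) (i : ℤ), Even (i + (n : ℤ)) → U m n i ∈ Icc ul uu)
    (hlim : ∀ᵐ p ∂volume.restrict halfPlane,
      Tendsto (fun m => gridFun (dx m) (dt m) (U m) p) atTop (𝓝 (u p))) :
    ∀ᵐ p ∂volume.restrict halfPlane,
      Tendsto (fun m => gridFun (dx m) (dt m) ((E m).gridFlux k V (dx m) (U m)) p) atTop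
        (𝓝 (kruzhkovFlux (f (k p.1)) c (u p) - |B c| * V p.1)) := by
  filter_upwards [hlim, ae_halfPlane_of_ae_fst hkI,
    ae_halfPlane_of_ae_fst (ae_tendsto_cellAverage hk hpos hdx),
    ae_halfPlane_of_ae_fst (ae_tendsto_cellAverage hV hpos hdx)] with p hp hkp hk_lim hV_lim
  have hU_mem (m : ℕ) : gridFun (dx m) (dt m) (U m) p ∈ Icc ul uu := gridFun_mem (hU m) p
  exact (tendsto_discreteEntropy_flux hf hE hδ (fun m => hk_cell m _) hkp hU_mem
    (isClosed_Icc.mem_of_tendsto hp (Eventually.of_forall hU_mem))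
    (hk_lim fun m => ⌊p.2 / dt m⌋₊) hp).sub
    ((tendsto_discreteEntropy_source hE hδ).mul (hV_lim fun m => ⌊p.2 / dt m⌋₊))

theorem DiscreteEntropy.abs_gridFlux_le {L' M : ℝ} (E : DiscreteEntropy f I S lam L')
    (hflux : ∀ κ ∈ I, ∀ v ∈ S, |E.flux κ v| ≤ M) (hsource : E.source ≤ M) {dx : ℝ}
    {U : ℕ → ℤ → ℝ} {n : ℕ} {i : ℤ} (hk : cellAverage k dx i ∈ I) (hU : U n i ∈ S)
    (hV : |cellAverage V dx i| ≤ MV) : |E.gridFlux k V dx U n i| ≤ M + M * MV := by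
  refine (abs_sub _ _).trans (add_le_add (hflux _ hk _ hU) ?_)
  rw [abs_mul, abs_of_nonneg E.source_nonneg]
  exact mul_le_mul hsource hV (abs_nonneg _) (E.source_nonneg.trans hsource)

theorem ae_tendsto_gridFun_initial (hu0 : LocallyIntegrable u0) (hpos : ∀ m, 0 < dx m)
    (hdx : Tendsto dx atTop (𝓝 0)) {dt : ℕ → ℝ} (hdt : ∀ m, 0 < dt m)
    (hU0 : ∀ (m : ℕ) (i : ℤ), Even i → U m 0 i = cellAverage u0 (dx m) i) :
    ∀ᵐ x, Tendsto (fun m => gridFun (dx m) (dt m) (U m) (x, 0)) atTop (𝓝 (u0 x)) := by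
  filter_upwards [ae_tendsto_cellAverage hu0 hpos hdx] with x hx
  refine (hx 0).congr fun m => ?_
  rw [gridFun_eq_of_mem_Ico _ (left_mem_Ico.2 (hdt m)),
    hU0 m _ (by simpa using even_gridIndex_add (dx m) 0 x)]
  rfl

theorem exists_abs_gridFun_le (hf : IsAffineFlux f B (Icc kl ku) (Icc ul uu) l L) {L' : ℕ → ℝ}
    {E : ∀ m, DiscreteEntropy f (Icc kl ku) (Icc ul uu) lam (L' m)}
    (hE : ∀ m, (E m).Approximates B c (δ m)) (hδ : Tendsto δ atTop (𝓝 0))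
    (hk : ∀ m i, cellAverage k (dx m) i ∈ Icc kl ku)
    (hV : ∀ m i, |cellAverage V (dx m) i| ≤ MV)
    (hU : ∀ (m n : ℕ) (i : ℤ), Even (i + (n : ℤ)) → U m n i ∈ Icc ul uu) (dt : ℕ → ℝ) :
    ∃ M, (∀ m p, |gridFun (dx m) (dt m) (fun n i => (E m).entropy (U m n i)) p| ≤ M) ∧
      ∀ m p, |gridFun (dx m) (dt m) ((E m).gridFlux k V (dx m) (U m)) p| ≤ M := by
  obtain ⟨δ₀, hδ₀⟩ := hδ.bddAbove_range
  obtain ⟨M, hM⟩ := exists_abs_discreteEntropy_le isCompact_Icc isCompact_Icc hf c δ₀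
  have hMm (m : ℕ) := hM (hE m) (hδ₀ (mem_range_self m))
  refine ⟨max M (M + M * MV), fun m p => ?_, fun m p => ?_⟩
  · exact abs_gridFun_le (fun n i hi => le_max_of_le_left ((hMm m).1 _ (hU m n i hi))) p
  · exact abs_gridFun_le (fun n i hi => le_max_of_le_right
      ((E m).abs_gridFlux_le (hMm m).2.1 (hMm m).2.2 (hk m i) (hU m n i hi) (hV m i))) p

theorem integrable_corrector {b s : ℝ × ℝ → ℝ} {A : ℝ} (hb : Measurable b) (hbA : ∀ p, |b p| ≤ A)
    (hs : Measurable s) (hs1 : ∀ p, |s p| ≤ 1) (hφ : Continuous φ) (hφc : HasCompactSupport φ)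
    (v w z : ℝ × ℝ) : Integrable fun p => (b (p + v) - b (p + w)) * s (p + z) * φ (p + z) := by
  refine ((hφ.integrable_of_hasCompactSupport hφc).comp_add_right z).bdd_mul (c := (A + A) * 1)
    (by fun_prop) (Eventually.of_forall fun p => ?_)
  rw [Real.norm_eq_abs, abs_mul]
  exact mul_le_mul ((abs_sub _ _).trans (add_le_add (hbA _) (hbA _))) (hs1 _) (abs_nonneg _)
    (add_nonneg ((abs_nonneg _).trans (hbA 0)) ((abs_nonneg _).trans (hbA 0)))

theorem DiscreteEntropy.measurable_subgradient {L' : ℝ} (E : DiscreteEntropy f I S lam L') :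
    Measurable E.subgradient :=
  (continuousOn_univ.1 (continuousOn_of_abs_sub_le fun v _ w _ =>
    E.abs_subgradient_sub_le v w)).measurable

theorem entropy_inequality_of_scheme (hu0 : LocallyIntegrable u0) (hk : LocallyIntegrable k)
    (hkI : ∀ᵐ x, k x ∈ Icc kl ku) (hV : Measurable V) (hVM : ∀ x, |V x| ≤ MV)
    (hkV : ∀ r > 0, ∀ᵐ x, |k (x + r) - k x| ≤ V (x + r) - V x)
    (hf : IsAffineFlux f B (Icc kl ku) (Icc ul uu) l L) (hlam : 0 < lam)
    (hCFL : lam * l ≤ 1 / 2) (hpos : ∀ m, 0 < dx m) (hdx : Tendsto dx atTop (𝓝 0))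
    (hscheme : ∀ m, IsPredictorCorrector f k u0 lam (dx m) (U m) (a m)) (hβ : 0 < β)
    (ha : ∀ (m n : ℕ) (i : ℤ), Even (i + (n : ℤ)) →
      |a m (n + 1) i| ≤ K * dx m ^ (2 / 3 + 2 * β))
    (hU : ∀ (m n : ℕ) (i : ℤ), Even (i + (n : ℤ)) → U m n i ∈ Icc ul uu)
    (hcubic : ∀ X T : ℝ, 0 < X → 0 < T → ∃ C, ∀ m, cubicSum (dx m) (lam * dx m) (U m) X T ≤ C)
    (hlim : ∀ᵐ p ∂volume.restrict halfPlane,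
      Tendsto (fun m => gridFun (dx m) (lam * dx m) (U m) p) atTop (𝓝 (u p)))
    (hφ : ContDiff ℝ 1 φ) (hφc : HasCompactSupport φ) (hφ0 : ∀ p ∈ halfPlane, 0 ≤ φ p) :
    0 ≤ (∫ p in halfPlane, |u p - c| * fderiv ℝ φ p (0, 1)) + (∫ x, |u0 x - c| * φ (x, 0)) +
      ∫ p in halfPlane,
        (kruzhkovFlux (f (k p.1)) c (u p) - |B c| * V p.1) * fderiv ℝ φ p (1, 0) := by
  obtain ⟨ε, δ, E, hε, hε_eq, hδ, hE⟩ := exists_discreteEntropy_seq hf hlam.le hCFL c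
    (fun m => Real.rpow_pos_of_pos (hpos m) β)
    (by simpa only [Real.zero_rpow hβ.ne'] using hdx.rpow_const (Or.inr hβ.le))
  obtain ⟨δ', hδ', hcorrector⟩ := exists_tendsto_corrector_le (K := K) hφ hφc hlam hβ hpos hdx hε
    hε_eq hcubic
  have hdt (m : ℕ) : 0 < lam * dx m := mul_pos hlam (hpos m)
  have hV_mem : ∀ᵐ x, V x ∈ Icc (-MV) MV := Eventually.of_forall fun x => abs_le.1 (hVM x)
  have hV_loc : LocallyIntegrable V :=
    locallyIntegrable_of_ae_mem_Icc hV.aestronglyMeasurable hV_mem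
  have hk_cell (m : ℕ) : ∀ i, cellAverage k (dx m) i ∈ Icc kl ku :=
    cellAverage_mem (hpos m) hk (convex_Icc _ _) isClosed_Icc hkI
  have hV_cell (m : ℕ) (i : ℤ) : |cellAverage V (dx m) i| ≤ MV :=
    abs_le.2 (cellAverage_mem (hpos m) hV_loc (convex_Icc _ _) isClosed_Icc hV_mem i)
  obtain ⟨M, hηM, hqM⟩ := exists_abs_gridFun_le hf hE hδ hk_cell hV_cell hU fun m => lam * dx m
  have hb (m : ℕ) := measurable_gridFun (dx m) (lam * dx m) fun n i => a m (n + 1) i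
  have hbK (m : ℕ) := abs_gridFun_le (dx := dx m) (dt := lam * dx m) (ha m)
  have hσ (m : ℕ) := (E m).measurable_subgradient
  refine lax_wendroff hlam hpos hdx hφ hφc hφ0 (fun m => measurable_gridFun _ _ _)
    (fun m => measurable_gridFun _ _ _) hηM hqM ?_
    (ae_tendsto_gridFun_gridFlux hpos hdx hf hE hδ hk hV_loc hkI hk_cell hU hlim)
    (fun m p hp => ?_) ?_ (fun m p hp => ?step) (fun m => ?_) hδ' fun m =>
      hcorrector m _ _ (hb m) (hbK m) (hσ m) (E m).abs_subgradient_le (E m).abs_subgradient_sub_le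
  case step =>
    exact (hscheme m).gridFun_entropy_step_le (E m) hlam (hpos m) (hk_cell m) (hU m)
      (abs_cellAverage_add_two_sub_le (hpos m) hk hV_loc (hkV _ (hpos m))) hp
  · filter_upwards [hlim] with p hp
    exact tendsto_discreteEntropy_entropy hE hδ (fun m => gridFun_mem (hU m) p) hp
  · rw [gridFun_eq_of_mem_Ico _ hp, gridFun_eq_of_mem_Ico _ (left_mem_Ico.2 (hdt m))]
  · filter_upwards [ae_tendsto_gridFun_initial hu0 hpos hdx hdt fun m => (hscheme m).1] with x hx
    exact tendsto_discreteEntropy_entropy hE hδ (fun m => gridFun_mem (hU m) _) hx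
  · exact (integrable_corrector (hb m) (hbK m) ((hσ m).comp (measurable_gridFun _ _ (U m)))
      (fun p => (E m).abs_subgradient_le _) hφ.continuous hφc _ _ _).integrableOn

end Limit

section LimitRegularity

theorem leftLim_mem_of_ae {k : ℝ → ℝ} {A : Set ℝ} (hk : BoundedVariationOn k univ)
    (hA : IsClosed A) (hkA : ∀ᵐ x, k x ∈ A) (x : ℝ) : Function.leftLim k x ∈ A := by
  refine hA.mem_of_frequently_of_tendsto (frequently_iff.2 fun {W} hW => ?_) (hk.tendsto_leftLim x)
  obtain ⟨a, ha, haW⟩ := mem_nhdsLT_iff_exists_Ioo_subset.1 hW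
  obtain ⟨z, hzA, hz⟩ := (Measure.dense_of_ae hkA).exists_between ha
  exact ⟨z, haW hz, hzA⟩

theorem rightLim_mem_of_ae {k : ℝ → ℝ} {A : Set ℝ} (hk : BoundedVariationOn k univ)
    (hA : IsClosed A) (hkA : ∀ᵐ x, k x ∈ A) (x : ℝ) : Function.rightLim k x ∈ A := by
  refine hA.mem_of_frequently_of_tendsto (frequently_iff.2 fun {W} hW => ?_)
    (hk.tendsto_rightLim x)
  obtain ⟨b, hb, hbW⟩ := mem_nhdsGT_iff_exists_Ioo_subset.1 hW
  obtain ⟨z, hzA, hz⟩ := (Measure.dense_of_ae hkA).exists_between hb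
  exact ⟨z, hbW hz, hzA⟩

theorem measurable_of_boundedVariationOn {k : ℝ → ℝ} (hk : BoundedVariationOn k univ) :
    Measurable k := by
  obtain ⟨p, q, hp, hq, rfl⟩ := hk.locallyBoundedVariationOn.exists_monotoneOn_sub_monotoneOn
  exact (monotoneOn_univ.1 hp).measurable.sub (monotoneOn_univ.1 hq).measurable

theorem ae_abs_add_sub_le_variationFun {k : ℝ → ℝ} {D : Finset ℝ} {P : Set ℝ}
    (hk : BoundedVariationOn k univ) (hD : ∀ x ∉ D, ContinuousAt k x) (hP : P.Countable)
    (hkP : ∀ x ∉ P, DifferentiableAt ℝ k x) {r : ℝ} (hr : 0 ≤ r) :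
    ∀ᵐ x, |k (x + r) - k x| ≤ variationFun k D (x + r) - variationFun k D x := by
  have hleft : ∀ᵐ x, Function.leftLim k x = k x := by
    filter_upwards [D.countable_toSet.ae_notMem volume] with x hx
    exact (hD x hx).continuousWithinAt.leftLim_eq
  filter_upwards [hleft,
    (measurePreserving_add_right volume r).quasiMeasurePreserving.ae hleft] with x hx hxr
  rw [← hx, ← hxr]
  exact abs_leftLim_sub_le_variationFun hk hD hP hkP (le_add_of_nonneg_right hr)

theorem integrable_comp_mul_of_continuousOn {α X : Type*} [MeasurableSpace α] {μ : Measure α}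
    [TopologicalSpace X] [T2Space X] [MeasurableSpace X] [BorelSpace X] {T : Set X} {F : X → ℝ}
    {g : α → X} {ψ : α → ℝ} (hT : IsCompact T) (hF : ContinuousOn F T) (hg : AEMeasurable g μ)
    (hgT : ∀ᵐ p ∂μ, g p ∈ T) (hψ : Integrable ψ μ) : Integrable (fun p => F (g p) * ψ p) μ := by
  obtain ⟨C, hC⟩ := hT.exists_bound_of_continuousOn hF
  have hmap : (μ.map g).restrict T = μ.map g :=
    Measure.restrict_eq_self_of_ae_mem ((ae_map_iff hg hT.measurableSet).2 hgT)
  have hF' : AEMeasurable F (μ.map g) := hmap ▸ hF.aemeasurable hT.measurableSet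
  exact hψ.bdd_mul (hF'.comp_aemeasurable hg).aestronglyMeasurable
    (hgT.mono fun p hp => hC _ hp)

end LimitRegularity

section EntropySolution

variable {f : ℝ → ℝ → ℝ} {B : ℝ → ℝ} {kl ku ul uu l L : ℝ} {k u0 : ℝ → ℝ} {D : Finset ℝ}
  {u : ℝ → ℝ → ℝ}

theorem IsAffineFlux.deriv_comp {I S : Set ℝ} (hf : IsAffineFlux f B I S l L) {x : ℝ}
    (hx : ∀ᶠ z in 𝓝 x, k z ∈ I) (c : ℝ) :
    deriv (fun z => f (k z) c) x = deriv k x * B c := by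
  have haffine : (fun z => f (k z) c) =ᶠ[𝓝 x] fun z => f (k x) c + (k z - k x) * B c := by
    filter_upwards [hx] with z hz
    linarith [hf.sub_eq _ hx.self_of_nhds _ hz c]
  rw [haffine.deriv_eq, deriv_const_add, deriv_mul_const_field, deriv_sub_const]

theorem IsAffineFlux.setIntegral_abs_deriv_comp_mul {I S : Set ℝ} (hf : IsAffineFlux f B I S l L)
    (hI : IsClosed I) (hk : BoundedVariationOn k univ) (hD : ∀ x ∉ D, ContinuousAt k x)
    (hkI : ∀ᵐ x, k x ∈ I) (c : ℝ) (φ : ℝ × ℝ → ℝ) :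
    ∫ p in {p : ℝ × ℝ | p.1 ∉ D ∧ 0 ≤ p.2}, |deriv (fun x => f (k x) c) p.1| * φ p =
      |B c| * ∫ p in halfPlane, |deriv k p.1| * φ p := by
  have hderiv (x : ℝ) (hx : x ∉ D) : deriv (fun x => f (k x) c) x = deriv k x * B c := by
    refine hf.deriv_comp ?_ c
    filter_upwards [D.finite_toSet.isClosed.isOpen_compl.mem_nhds hx] with z hz
    rw [← (hD z hz).continuousWithinAt.leftLim_eq]
    exact leftLim_mem_of_ae hk hI hkI z
  have hmeas : MeasurableSet {p : ℝ × ℝ | p.1 ∉ D ∧ 0 ≤ p.2} :=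
    (measurable_fst D.measurableSet.compl).inter (measurableSet_le_snd 0)
  have hD_null : ∀ᵐ p : ℝ × ℝ, p.1 ∉ D :=
    Measure.quasiMeasurePreserving_fst.ae (D.countable_toSet.ae_notMem volume)
  have hset : {p : ℝ × ℝ | p.1 ∉ D ∧ 0 ≤ p.2} =ᵐ[volume] halfPlane := by
    filter_upwards [hD_null] with p hp
    exact propext (and_iff_right hp)
  rw [← integral_const_mul, ← setIntegral_congr_set hset]
  refine setIntegral_congr_fun hmeas fun p hp => ?_
  simp only [hderiv p.1 hp.1, abs_mul]
  ring

theorem IsAffineFlux.setIntegral_abs_deriv_comp_mul_add_sum {I S : Set ℝ}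
    (hf : IsAffineFlux f B I S l L) (hI : IsClosed I) (hk : BoundedVariationOn k univ)
    (hD : ∀ x ∉ D, ContinuousAt k x) (hkI : ∀ᵐ x, k x ∈ I) (c : ℝ) {φ : ℝ × ℝ → ℝ}
    (hφ : ContDiff ℝ 1 φ) (hφc : HasCompactSupport φ) :
    (∫ p in {p : ℝ × ℝ | p.1 ∉ D ∧ 0 ≤ p.2}, |deriv (fun x => f (k x) c) p.1| * φ p) +
        ∑ y ∈ D, ∫ t in Ici (0 : ℝ),
          |f (Function.rightLim k y) c - f (Function.leftLim k y) c| * φ (y, t) =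
      -(|B c| * ∫ p in halfPlane, variationFun k D p.1 * fderiv ℝ φ p (1, 0)) := by
  rw [hf.setIntegral_abs_deriv_comp_mul hI hk hD hkI, setIntegral_variationFun_mul_fderiv hk D hφ
    hφc, mul_neg, neg_neg, mul_add, Finset.mul_sum]
  congr 1
  refine Finset.sum_congr rfl fun y _ => ?_
  rw [← integral_const_mul, hf.abs_flux_sub_eq (leftLim_mem_of_ae hk hI hkI y)
    (rightLim_mem_of_ae hk hI hkI y)]
  simp only [jumpAt, mul_assoc]

theorem IsAffineFlux.isEntropySolution (hf : IsAffineFlux f B (Icc kl ku) (Icc ul uu) l L)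
    (hk : BoundedVariationOn k univ) (hkI : ∀ᵐ x, k x ∈ Icc kl ku)
    (hD : ∀ x ∉ D, ContinuousAt k x)
    (hu : AEMeasurable (fun p : ℝ × ℝ => u p.1 p.2) (volume.restrict halfPlane))
    (hu_mem : ∀ᵐ p ∂volume.restrict halfPlane, u p.1 p.2 ∈ Icc ul uu)
    (h : ∀ (c : ℝ) (φ : ℝ × ℝ → ℝ), ContDiff ℝ 1 φ → HasCompactSupport φ →
      (∀ p ∈ halfPlane, 0 ≤ φ p) →
      0 ≤ (∫ p in halfPlane, |u p.1 p.2 - c| * fderiv ℝ φ p (0, 1)) +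
        (∫ x, |u0 x - c| * φ (x, 0)) + ∫ p in halfPlane,
          (kruzhkovFlux (f (k p.1)) c (u p.1 p.2) - |B c| * variationFun k D p.1) *
            fderiv ℝ φ p (1, 0)) :
    IsEntropySolution f k D u0 u := by
  refine ⟨memLp_top_of_bound hu.aestronglyMeasurable (max |ul| |uu|) (hu_mem.mono fun p hp =>
    abs_le_max_abs_abs hp.1 hp.2), fun c φ hφ hφc hφ0 => ?_⟩
  replace hφ : ContDiff ℝ 1 φ := hφ.of_le (by simp)
  have hdφ (v : ℝ × ℝ) : IntegrableOn (fun p => fderiv ℝ φ p v) halfPlane :=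
    (((hφ.continuous_fderiv one_ne_zero).clm_apply
      continuous_const).integrable_of_hasCompactSupport (hφc.fderiv_apply ℝ v)).integrableOn
  obtain ⟨M, hM⟩ := exists_abs_variationFun_le hk D
  have hV : IntegrableOn (fun p => variationFun k D p.1 * fderiv ℝ φ p (1, 0)) halfPlane :=
    (hdφ _).bdd_mul ((measurable_variationFun hk D).comp measurable_fst).aestronglyMeasurable
      (Eventually.of_forall fun p => hM p.1)
  have hη : IntegrableOn (fun p => |u p.1 p.2 - c| * fderiv ℝ φ p (0, 1)) halfPlane :=
    integrable_comp_mul_of_continuousOn (F := fun v => |v - c|) isCompact_Icc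
      (by fun_prop) hu hu_mem (hdφ _)
  have hq : IntegrableOn (fun p => kruzhkovFlux (f (k p.1)) c (u p.1 p.2) *
      fderiv ℝ φ p (1, 0)) halfPlane :=
    integrable_comp_mul_of_continuousOn (g := fun p : ℝ × ℝ => (k p.1, u p.1 p.2))
      (isCompact_Icc.prod isCompact_Icc) (hf.continuousOn_kruzhkovFlux c)
      (((measurable_of_boundedVariationOn hk).comp measurable_fst).aemeasurable.prodMk hu)
      ((ae_halfPlane_of_ae_fst hkI).and hu_mem) (hdφ _)
  have hineq := h c φ hφ hφc hφ0
  simp only [sub_mul, mul_assoc] at hineq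
  rw [integral_sub hq (hV.const_mul _), integral_const_mul] at hineq
  rw [add_assoc (_ + _), hf.setIntegral_abs_deriv_comp_mul_add_sum isClosed_Icc hk hD hkI c hφ hφc]
  simp only [(hasDerivAt_slice_right hφ _).deriv, (hasDerivAt_slice_left hφ _).deriv]
  simp only [kruzhkovFlux] at hq hineq
  rw [integral_add hη hq]
  linarith

theorem mainTheorem3_general {P : Set ℝ} (hu0_meas : AEStronglyMeasurable u0 volume)
    (hu0 : ∀ᵐ x, u0 x ∈ Icc ul uu) (hk_bv : BoundedVariationOn k univ)
    (hk : ∀ᵐ x, k x ∈ Icc kl ku) (hD : ∀ x ∉ D, ContinuousAt k x) (hP : P.Countable)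
    (hkP : ∀ x ∉ P, DifferentiableAt ℝ k x)
    (hf : IsAffineFlux f B (Icc kl ku) (Icc ul uu) l L) {lam : ℝ} (hlam : 0 < lam)
    (hCFL : lam * l ≤ 1 / 2) {dx : ℕ → ℝ} (hdx_pos : ∀ m, 0 < dx m)
    (hdx : Tendsto dx atTop (𝓝 0)) {U a : ℕ → ℕ → ℤ → ℝ}
    (hscheme : ∀ m, IsPredictorCorrector f k u0 lam (dx m) (U m) (a m))
    {K α : ℝ} (hα : 2 / 3 < α)
    (ha : ∀ (m n : ℕ) (i : ℤ), Even (i + (n : ℤ)) → |a m (n + 1) i| ≤ K * dx m ^ α)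
    (hbound : ∀ (m n : ℕ) (i : ℤ), Even (i + (n : ℤ)) → U m n i ∈ Icc ul uu)
    (hcubic : ∀ X T : ℝ, 0 < X → 0 < T → ∃ C : ℝ, ∀ m, cubicSum (dx m) (lam * dx m) (U m) X T ≤ C)
    (hconv : ∀ᵐ p ∂volume.restrict halfPlane,
      Tendsto (fun m => approxSolution (dx m) (lam * dx m) (U m) p.1 p.2) atTop
        (𝓝 (u p.1 p.2))) :
    IsEntropySolution f k D u0 u := by
  obtain ⟨β, hβ, rfl⟩ : ∃ β > 0, α = 2 / 3 + 2 * β :=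
    ⟨(α - 2 / 3) / 2, by linarith, by ring⟩
  obtain ⟨M, hM⟩ := exists_abs_variationFun_le hk_bv D
  simp only [approxSolution_eq_gridFun, Prod.mk.eta] at hconv
  have hu_meas : AEMeasurable (fun p : ℝ × ℝ => u p.1 p.2) (volume.restrict halfPlane) :=
    aemeasurable_of_tendsto_metrizable_ae' (fun m => (measurable_gridFun _ _ _).aemeasurable) hconv
  have hu_mem : ∀ᵐ p ∂volume.restrict halfPlane, u p.1 p.2 ∈ Icc ul uu :=
    hconv.mono fun p hp =>
      isClosed_Icc.mem_of_tendsto hp (Eventually.of_forall fun m => gridFun_mem (hbound m) p)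
  refine hf.isEntropySolution hk_bv hk hD hu_meas hu_mem fun c φ hφ hφc hφ0 => ?_
  exact entropy_inequality_of_scheme (locallyIntegrable_of_ae_mem_Icc hu0_meas hu0)
    (locallyIntegrable_of_ae_mem_Icc
      (measurable_of_boundedVariationOn hk_bv).aestronglyMeasurable hk)
    hk (measurable_variationFun hk_bv D) hM
    (fun r hr => ae_abs_add_sub_le_variationFun hk_bv hD hP hkP hr.le) hf hlam hCFL hdx_pos hdx
    hscheme hβ ha hbound hcubic hconv hφ hφc hφ0

end EntropySolution

theorem mainTheorem3
    -- initial datum in L∞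
    (ul uu : ℝ) (u0 : ℝ → ℝ) (hu0_meas : AEStronglyMeasurable u0 volume)
    (hu0 : ∀ᵐ x : ℝ, u0 x ∈ Set.Icc ul uu)
    -- coefficient: bounded variation, piecewise C¹, finitely many discontinuities
    (kl ku : ℝ) (k : ℝ → ℝ) (D : Finset ℝ)
    (hk_bv : BoundedVariationOn k Set.univ)
    (hk : ∀ᵐ x : ℝ, k x ∈ Set.Icc kl ku)
    (hD : ∀ x : ℝ, x ∈ D ↔ ¬ ContinuousAt k x)
    (hk_C1 : ∃ P : Finset ℝ, ContDiffOn ℝ 1 k ((P : Set ℝ)ᶜ))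
    -- flux: C³ in the state; C² in the coefficient with vanishing second derivative
    (f : ℝ → ℝ → ℝ)
    (hf_u : ∀ κ ∈ Set.Icc kl ku, ContDiffOn ℝ 3 (f κ) (Set.Icc ul uu))
    (hf_k : ∀ v : ℝ, ContDiffOn ℝ 2 (fun κ => f κ v) (Set.Icc kl ku))
    (hf_kk : ∀ v : ℝ, ∀ κ ∈ Set.Icc kl ku,
      iteratedDerivWithin 2 (fun κ' => f κ' v) (Set.Icc kl ku) κ = 0)
    -- fixed mesh ratio, with the CFL condition of the Lax–Friedrichs step
    (lam : ℝ) (hlam : 0 < lam)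
    (hCFL : ∀ κ ∈ Set.Icc kl ku, ∀ v ∈ Set.Icc ul uu,
      lam * |derivWithin (f κ) (Set.Icc ul uu) v| ≤ 1 / 2)
    -- mesh sizes tending to zero, and the scheme on each mesh
    (dx : ℕ → ℝ) (hdx_pos : ∀ m, 0 < dx m) (hdx : Filter.Tendsto dx Filter.atTop (nhds 0))
    (U a : ℕ → ℕ → ℤ → ℝ)
    (hscheme : ∀ m, IsPredictorCorrector f k u0 lam (dx m) (U m) (a m))
    -- size of the corrections
    (K α : ℝ) (hα : 2 / 3 < α)
    (ha : ∀ (m n : ℕ) (i : ℤ), Even (i + (n : ℤ)) → |a m (n + 1) i| ≤ K * dx m ^ α)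
    -- uniform bound, local cubic estimate, convergence almost everywhere
    (hbound : ∀ (m n : ℕ) (i : ℤ), Even (i + (n : ℤ)) → U m n i ∈ Set.Icc ul uu)
    (hcubic : ∀ X T : ℝ, 0 < X → 0 < T →
      ∃ C : ℝ, ∀ m, cubicSum (dx m) (lam * dx m) (U m) X T ≤ C)
    (u : ℝ → ℝ → ℝ)
    (hconv : ∀ᵐ p : ℝ × ℝ ∂(MeasureTheory.volume.restrict {p : ℝ × ℝ | 0 ≤ p.2}),
      Filter.Tendsto (fun m => approxSolution (dx m) (lam * dx m) (U m) p.1 p.2)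
        Filter.atTop (nhds (u p.1 p.2))) :
    IsEntropySolution f k D u0 u := by
  obtain ⟨P, hP⟩ := hk_C1
  obtain ⟨x, hx⟩ := hk.exists
  have hf_lip (κ) (hκ : κ ∈ Icc kl ku) (v) (hv : v ∈ Icc ul uu) (w) (hw : w ∈ Icc ul uu) :
      |f κ v - f κ w| ≤ 1 / 2 / lam * |v - w| :=
    abs_sub_le_of_abs_derivWithin_le (convex_Icc _ _) ((hf_u κ hκ).differentiableOn (by norm_num))
      (fun z hz => (le_div_iff₀' hlam).2 (hCFL κ hκ z hz)) hv hw
  obtain ⟨B, L, hf⟩ := exists_isAffineFlux (hx.1.trans hx.2) hf_k hf_kk hf_lip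
  have hkP (x) (hx : x ∉ (P : Set ℝ)) : DifferentiableAt ℝ k x :=
    (hP.differentiableOn one_ne_zero).differentiableAt
      (P.finite_toSet.isClosed.isOpen_compl.mem_nhds hx)
  exact mainTheorem3_general hu0_meas hu0 hk_bv hk (fun x hx => not_not.1 (mt (hD x).2 hx))
    P.countable_toSet hkP hf hlam (mul_div_cancel₀ _ hlam.ne').le hdx_pos hdx hscheme hα ha
    hbound hcubic hconv
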